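/- Let $\mathcal H$ be the Hilbert space with orthonormal basis $e^{(n)}_{ij}$, $n\in\frac12\mathbb N$, $i,j\in\{-n,-n+1,\dots,n\}$, and let $\alpha,\beta$ be the bounded operators on $\mathcal H$ (the generators of $SU_q(2)$ for $q=0$) given by $$\alpha e^{(n)}_{ij}=e^{(n-1/2)}_{i-1/2,\,j-1/2}\ \text{ if } i>-n \text{ and } j>-n,\qquad \alpha e^{(n)}_{ij}=0\ \text{ if } i=-n \text{ or } j=-n,$$ $$\beta e^{(n)}_{ij}=0\ \text{ if } i\ne -n \text{ and } j\neq -n,\qquad \beta e^{(n)}_{-n,j}=e^{(n-1/2)}_{-(n-1/2),\,j-1/2}\ \text{ if } j\neq -n,\qquad \beta e^{(n)}_{i,-n}=-e^{(n+1/2)}_{i+1/2,\,-(n+1/2)}.$$ Let $A$ be the C*-algebra of operators on $\mathcal H$ generated by $\alpha$ and $\beta$; it contains $1=\alpha\alpha^*$. For $f\in C^\infty(S^1)$ with Fourier coefficients $\hat f_n$ put $$f(\beta)=\sum_{n>0}\hat f_n\beta^n+\sum_{n<0}\hat f_n\beta^{*(-n)}+\hat f_0\,\beta^*\beta .$$ Let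 $\mathcal A$ be the set of all operators $$a=\sum_{k,\ell\ge 0}\alpha^{*k}f_{k\ell}(\beta)\,\alpha^{\ell}+\sum_{\ell\ge0}\lambda_\ell\,\alpha^\ell+\sum_{k>0}\lambda'_k\,\alpha^{*k},$$ where $\lambda,\lambda'$ are sequences of complex numbers of rapid decay and $(f_{k\ell})$ is a double sequence of rapid decay with values in the Fréchet space $C^\infty(S^1)$, i.e. $\sup_{k,\ell,\theta}(1+k+\ell)^p\,|\partial_\theta^m f_{k\ell}(\theta)|<\infty$ for all $m,p\in\mathbb N$. Then $\mathcal A\subset A$, and $\mathcal A$ is a unital subalgebra of $A$ which is stable under holomorphic functional calculus in $A$: for every $a\in\mathcal A$ and every function $g$ holomorphic on an open neighbourhood $U$ of the spectrum of $a$ in $A$, one has $$g(a)=\frac1{2\pi i}\oint_\Gamma g(z)(z-a)^{-1}\,dz\in\mathcal A$$ (for any $C^1$ cycle $\Gamma$ in $U\setminus\mathrm{Spec}_A(a)$ with winding number $1$ around each point of $\mathrm{Spec}_A(a)$ and $0$ around each point outside $U$). In particular, if $a\in\mathcal A$ is invertible in $A$, then $a^{-1}\in\mathcal A$. -/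

import Mathlib

open Set Topology
open scoped ContDiff InnerProductSpace

noncomputable section

/-! ### Holomorphic functional calculus in a unital complex Banach algebra -/

/-- A `C¹` cycle in `U \ K` surrounding `K`: finitely many closed `C¹` curves, parametrized by
`[0, 1]`, with total winding number `1` around each point of `K` and `0` around each point outside
`U`. (A `C¹` curve on `[0, 1]` is taken as the restriction of a `C¹` function on `ℝ`.) -/
structure SurroundingCycle (K U : Set ℂ) where
  /-- the number of curves -/
  card : ℕ
  /-- the curves -/
  path : Fin card → ℝ → ℂ
  contDiff : ∀ j, ContDiff ℝ 1 (path j)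
  closed : ∀ j, path j 0 = path j 1
  mem : ∀ j, ∀ t ∈ Icc (0 : ℝ) 1, path j t ∈ U \ K
  winding_eq_one : ∀ z ∈ K,
    (2 * Real.pi * Complex.I)⁻¹ *
      ∑ j, ∫ t in (0 : ℝ)..1, deriv (path j) t / (path j t - z) = 1
  winding_eq_zero : ∀ z ∉ U,
    (2 * Real.pi * Complex.I)⁻¹ *
      ∑ j, ∫ t in (0 : ℝ)..1, deriv (path j) t / (path j t - z) = 0

/-- The Riesz–Dunford integral `(2πi)⁻¹ ∮_Γ f(z) (z - x)⁻¹ dz`; it is `f(x)` if `f` is holomorphic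
on `U` and `Γ` is a cycle in `U` surrounding the spectrum of `x`. -/
def dunfordIntegral {B : Type*} [NormedRing B] [NormedAlgebra ℂ B] [CompleteSpace B]
    (f : ℂ → ℂ) {K U : Set ℂ} (Γ : SurroundingCycle K U) (x : B) : B :=
  (2 * Real.pi * Complex.I : ℂ)⁻¹ •
    ∑ j, ∫ t in (0 : ℝ)..1, (f (Γ.path j t) * deriv (Γ.path j) t) • resolvent x (Γ.path j t)

/-- A subalgebra `S` of a unital Banach algebra `B` is stable under holomorphic functional
calculus: `f(x) ∈ S` for all `x ∈ S` and all `f` holomorphic on a neighbourhood of the spectrum of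
`x` in `B`. -/
def StableUnderHolomorphicCalculus {B : Type*} [NormedRing B] [NormedAlgebra ℂ B]
    [CompleteSpace B] (S : Subalgebra ℂ B) : Prop :=
  ∀ x ∈ S, ∀ U : Set ℂ, IsOpen U → spectrum ℂ x ⊆ U → ∀ f : ℂ → ℂ, DifferentiableOn ℂ f U →
    ∀ Γ : SurroundingCycle (spectrum ℂ x) U, dunfordIntegral f Γ x ∈ S

namespace SUq0

/-! ### The Hilbert space and the operators `α`, `β` for `q = 0` -/

/-- The labels of the orthonormal basis `e_{ij}^{(n)}`, where `n ∈ ½ℕ` and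
`i, j ∈ {-n, -n+1, …, n}`, encoded by the natural numbers
`N = 2n`, `a = n + i`, `b = n + j`, so that `0 ≤ a, b ≤ N`. -/
@[ext]
structure Idx where
  N : ℕ
  a : ℕ
  b : ℕ
  ha : a ≤ N
  hb : b ≤ N

/-- The Hilbert space with orthonormal basis `e_{ij}^{(n)}`. -/
abbrev H : Type := lp (fun _ : Idx => ℂ) 2

/-- The basis vector `e_{ij}^{(n)}`. -/
def e (p : Idx) : H := by
  classical exact lp.single 2 p 1

theorem e_apply_self (p : Idx) : e p p = 1 := by
  simp [e]

theorem e_apply_ne {p r : Idx} (h : r ≠ p) : e p r = 0 := by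
  simp [e, h]

theorem sum_bound (c : Idx → ℂ) (φ : Idx → Idx) (hc : ∀ p, ‖c p‖ ≤ 1)
    (hφ : InjOn φ {p | c p ≠ 0}) (ξ : H) (s : Finset Idx) :
    ∑ p ∈ s, ‖c p * ξ (φ p)‖ ^ (2 : ENNReal).toReal ≤ ‖ξ‖ ^ (2 : ENNReal).toReal := by
  classical
  have h2 : (2 : ENNReal).toReal = 2 := by simp
  calc ∑ p ∈ s, ‖c p * ξ (φ p)‖ ^ (2 : ENNReal).toReal
      = ∑ p ∈ s with c p ≠ 0, ‖c p * ξ (φ p)‖ ^ (2 : ENNReal).toReal := by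
        rw [Finset.sum_filter]
        refine Finset.sum_congr rfl fun p _ => ?_
        split_ifs with h
        · rfl
        · simp only [ne_eq, not_not] at h
          simp [h]
    _ ≤ ∑ p ∈ s with c p ≠ 0, ‖ξ (φ p)‖ ^ (2 : ENNReal).toReal := by
        refine Finset.sum_le_sum fun p _ => ?_
        refine Real.rpow_le_rpow (norm_nonneg _) ?_ (by simp)
        rw [norm_mul]
        exact mul_le_of_le_one_left (norm_nonneg _) (hc p)
    _ = ∑ r ∈ (s.filter fun p => c p ≠ 0).image φ, ‖ξ r‖ ^ (2 : ENNReal).toReal := by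
        rw [Finset.sum_image]
        intro p hp r hr h
        exact hφ (by simpa using (Finset.mem_filter.1 hp).2)
          (by simpa using (Finset.mem_filter.1 hr).2) h
    _ ≤ ‖ξ‖ ^ (2 : ENNReal).toReal := lp.sum_rpow_le_norm_rpow (by simp) ξ _

/-- The bounded operator `(T ξ)(p) = c(p) ξ(φ(p))`, for `|c| ≤ 1` and `φ` injective on the support
of `c`. -/
def coordOp (c : Idx → ℂ) (φ : Idx → Idx) (hc : ∀ p, ‖c p‖ ≤ 1)
    (hφ : InjOn φ {p | c p ≠ 0}) : H →L[ℂ] H :=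
  LinearMap.mkContinuous
    { toFun := fun ξ => ⟨fun p => c p * ξ (φ p), memℓp_gen' (sum_bound c φ hc hφ ξ)⟩
      map_add' := fun ξ η => by
        ext p
        exact mul_add (c p) (ξ (φ p)) (η (φ p))
      map_smul' := fun z ξ => by
        ext p
        simp [mul_left_comm] }
    1 (fun ξ => by
      rw [one_mul]
      exact lp.norm_le_of_forall_sum_le (by simp) (norm_nonneg _) (sum_bound c φ hc hφ ξ))

theorem coordOp_apply (c : Idx → ℂ) (φ : Idx → Idx) (hc : ∀ p, ‖c p‖ ≤ 1)
    (hφ : InjOn φ {p | c p ≠ 0}) (ξ : H) (p : Idx) :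
    coordOp c φ hc hφ ξ p = c p * ξ (φ p) := rfl

/-- The map `(n, i, j) ↦ (n + ½, i + ½, j + ½)`. -/
def shiftUp (p : Idx) : Idx :=
  ⟨p.N + 1, p.a + 1, p.b + 1, Nat.succ_le_succ p.ha, Nat.succ_le_succ p.hb⟩

theorem shiftUp_injective : Function.Injective shiftUp := by
  rintro ⟨N, a, b, h1, h2⟩ ⟨N', a', b', h1', h2'⟩ h
  simpa [shiftUp] using h

/-- The operator `α`: `α e_{ij}^{(n)} = e_{i-½,j-½}^{(n-½)}` if `i, j > -n`, and
`α e_{ij}^{(n)} = 0` if `i = -n` or `j = -n`. -/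
def α : H →L[ℂ] H :=
  coordOp (fun _ => 1) shiftUp (by simp) shiftUp_injective.injOn

theorem α_e_shiftUp (p : Idx) : α (e (shiftUp p)) = e p := by
  ext r
  rw [α, coordOp_apply, one_mul]
  by_cases h : r = p
  · rw [h, e_apply_self, e_apply_self]
  · rw [e_apply_ne h, e_apply_ne fun h' => h (shiftUp_injective h')]

theorem α_e_boundary (p : Idx) (hp : p.a = 0 ∨ p.b = 0) : α (e p) = 0 := by
  ext r
  rw [α, coordOp_apply, one_mul, e_apply_ne, lp.coeFn_zero, Pi.zero_apply]
  rintro rfl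
  simp [shiftUp] at hp

/-- The coefficients of `β`: `(β ξ)(p) = βcoeff p * ξ (βindex p)`. -/
def βcoeff (p : Idx) : ℂ := if p.a = 0 then 1 else if p.b = 0 then -1 else 0

/-- The label of the basis vector that `β` maps to `± e_p`, for `p.a = 0` or `p.b = 0`. -/
def βindex (p : Idx) : Idx :=
  if p.a = 0 then ⟨p.N + 1, 0, p.b + 1, Nat.zero_le _, Nat.succ_le_succ p.hb⟩
  else ⟨p.N - 1, p.a - 1, 0, Nat.sub_le_sub_right p.ha 1, Nat.zero_le _⟩

theorem norm_βcoeff_le (p : Idx) : ‖βcoeff p‖ ≤ 1 := by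
  unfold βcoeff
  split_ifs <;> simp

theorem βindex_injOn : InjOn βindex {p | βcoeff p ≠ 0} := by
  rintro ⟨N, a, b, h1, h2⟩ hp ⟨N', a', b', h1', h2'⟩ hp' h
  simp only [βcoeff, mem_ofPred_eq] at hp hp'
  simp only [βindex] at h
  split_ifs at h hp hp' <;> simp_all
  omega

/-- The operator `β`: `β e_{ij}^{(n)} = 0` if `i ≠ -n` and `j ≠ -n`,
`β e_{-n,j}^{(n)} = e_{-(n-½),j-½}^{(n-½)}` if `j ≠ -n`, and
`β e_{i,-n}^{(n)} = -e_{i+½,-(n+½)}^{(n+½)}`. -/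
def β : H →L[ℂ] H := coordOp βcoeff βindex norm_βcoeff_le βindex_injOn

theorem β_e_interior (p : Idx) (ha : p.a ≠ 0) (hb : p.b ≠ 0) : β (e p) = 0 := by
  ext r
  rw [β, coordOp_apply, lp.coeFn_zero, Pi.zero_apply]
  by_cases h : βindex r = p
  · subst h
    simp only [βindex] at ha hb
    split_ifs at ha hb <;> simp_all
  · rw [e_apply_ne h, mul_zero]

theorem β_e_left (N b : ℕ) (hb : b ≤ N) :
    β (e ⟨N + 1, 0, b + 1, Nat.zero_le _, Nat.succ_le_succ hb⟩) =
      e ⟨N, 0, b, Nat.zero_le _, hb⟩ := by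
  ext ⟨N', a', b', h1, h2⟩
  rw [β, coordOp_apply]
  by_cases ha : a' = 0
  · subst ha
    by_cases h : N' = N ∧ b' = b
    · obtain ⟨rfl, rfl⟩ := h
      simp [βcoeff, βindex, e_apply_self]
    · rw [e_apply_ne (by simpa [βindex] using h), e_apply_ne (by simpa using h), mul_zero]
  · rw [e_apply_ne (by simp [βindex, ha]), e_apply_ne (by simp [ha]), mul_zero]

theorem β_e_right (N a : ℕ) (ha : a ≤ N) :
    β (e ⟨N, a, 0, ha, Nat.zero_le _⟩) =
      -e ⟨N + 1, a + 1, 0, Nat.succ_le_succ ha, Nat.zero_le _⟩ := by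
  ext ⟨N', a', b', h1, h2⟩
  rw [β, coordOp_apply, lp.coeFn_neg, Pi.neg_apply]
  by_cases h0 : a' = 0
  · subst h0
    rw [e_apply_ne (by simp [βindex]), e_apply_ne (by simp), mul_zero, neg_zero]
  · by_cases hb : b' = 0
    · subst hb
      obtain ⟨a', rfl⟩ := Nat.exists_eq_succ_of_ne_zero h0
      obtain ⟨N', rfl⟩ := Nat.exists_eq_succ_of_ne_zero (by omega : N' ≠ 0)
      by_cases h : N' = N ∧ a' = a
      · obtain ⟨rfl, rfl⟩ := h
        simp [βcoeff, βindex, e_apply_self]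
      · rw [e_apply_ne (by simpa [βindex] using h), e_apply_ne (by simpa using h), mul_zero,
          neg_zero]
    · rw [e_apply_ne (p := ⟨N + 1, a + 1, 0, _, _⟩) (by simp [hb])]
      simp [βcoeff, h0, hb]

/-- The C*-algebra `A` of operators on `H` generated by `α` and `β`. (It contains `1 = α α*`.) -/
def cstarA : StarSubalgebra ℂ (H →L[ℂ] H) :=
  (StarAlgebra.adjoin ℂ {α, β}).topologicalClosure

instance : CompleteSpace cstarA :=
  inferInstanceAs (CompleteSpace (StarAlgebra.adjoin ℂ {α, β}).topologicalClosure)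

/-! ### The smooth algebra -/

/-- `β ^ n` for `n > 0`, `(β*) ^ (-n)` for `n < 0`, and the projection `β* β` for `n = 0`. -/
def βpow (n : ℤ) : H →L[ℂ] H :=
  if 0 < n then β ^ n.toNat else if n < 0 then (star β) ^ (-n).toNat else star β * β

/-- `f(β) = ∑_{n > 0} f̂_n β ^ n + ∑_{n < 0} f̂_n (β*) ^ (-n) + f̂_0 e`, with `e = β* β` and
`f̂_n` the Fourier coefficients of the smooth `2π`-periodic function `f` of `θ`. (The series
converges absolutely, since `(f̂_n)` decays rapidly and `‖β‖ ≤ 1`.) -/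
def ofβ (f : ℝ → ℂ) : H →L[ℂ] H :=
  ∑' n : ℤ, fourierCoeffOn Real.two_pi_pos f n • βpow n

/-- Sequences of complex numbers of rapid decay. -/
def RapidDecay (c : ℕ → ℂ) : Prop :=
  ∀ p : ℕ, ∃ C : ℝ, ∀ k : ℕ, (1 + (k : ℝ)) ^ p * ‖c k‖ ≤ C

/-- Double sequences of rapid decay with values in the Fréchet space `C^∞(S¹)`, whose elements are
the smooth `2π`-periodic functions of `θ`, with the seminorms `sup |∂_θ^m f|`. -/
structure SmoothRapidDecay (f : ℕ → ℕ → ℝ → ℂ) : Prop where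
  contDiff : ∀ k l, ContDiff ℝ ∞ (f k l)
  periodic : ∀ k l, Function.Periodic (f k l) (2 * Real.pi)
  decay : ∀ m p : ℕ, ∃ C : ℝ, ∀ (k l : ℕ) (θ : ℝ),
    (1 + (k : ℝ) + (l : ℝ)) ^ p * ‖iteratedDeriv m (f k l) θ‖ ≤ C

/-- The operators
`∑_{k,l ≥ 0} α*^k f_{kl}(β) α^l + ∑_{l ≥ 0} lam_l α^l + ∑_{k > 0} lam'_k α*^k`
(norm-convergent series) with `(f_{kl})`, `lam`, `lam'` of rapid decay. -/
def smoothA : Set (H →L[ℂ] H) :=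
  {x | ∃ (f : ℕ → ℕ → ℝ → ℂ) (lam lam' : ℕ → ℂ),
    SmoothRapidDecay f ∧ RapidDecay lam ∧ RapidDecay lam' ∧
    ∃ x₁ x₂ x₃ : H →L[ℂ] H,
      HasSum (fun p : ℕ × ℕ => (star α) ^ p.1 * ofβ (f p.1 p.2) * α ^ p.2) x₁ ∧
      HasSum (fun l : ℕ => lam l • α ^ l) x₂ ∧
      HasSum (fun k : ℕ => lam' (k + 1) • (star α) ^ (k + 1)) x₃ ∧
      x = x₁ + x₂ + x₃}

end SUq0

end

/-!
In the coordinates `k = min(a, b)`, `d = a - b`, `m = N - max(a, b)` on the basis, `α` lowers `k`,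
`β` shifts `d` on the vectors with `k = 0` and kills the others, up to signs, and `m` never changes.
Hence the C*-algebra is the closed span of the atoms `α^n`, `α*^n` and `α*^k β^n α^l`, the latter
being matrix units in `k`, `l` tensored with shifts of `d`, and the smooth algebra consists of the
series in the atoms with rapidly decreasing coefficients. The corresponding weighted `ℓ¹` norms can
be chosen submultiplicative, so the smooth algebra is an intersection of Banach algebras, and once
it is closed under inverses, Cauchy integrals of resolvents converge in each of them.

Let `y` be the inverse of a smooth `x`. Modulo the atoms `α*^k β^n α^l`, `x` is a function on the
circle, its symbol, whose values are approximate eigenvalues of `x`; so the symbol has no zero, and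
its inverse lifts to a smooth `T`. Now `r = 1 - x T` and `r' = 1 - T x` are series in the
`α*^k β^n α^l`, and `y = T + T r + r' y r`. The coefficients of the corner `r' y r` are controlled
by the matrix coefficients of `y`, which decrease rapidly in the degree of `β` because `y`, like
`x`, is a smooth vector for the circle action that rotates `β`.
-/

noncomputable section

open Filter Asymptotics
open scoped ENNReal

/-! ### Gauges on Banach algebras -/

section HolomorphicCalculus

variable {A B : Type*} [NormedRing A] [NormedAlgebra ℂ A] [NormedRing B] [NormedAlgebra ℂ B]

theorem map_resolvent (φ : A →ₐ[ℂ] B) {x : A} {z : ℂ} (hz : z ∉ spectrum ℂ x) :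
    φ (resolvent x z) = resolvent (φ x) z := by
  obtain ⟨u, hu⟩ : IsUnit (algebraMap ℂ A z - x) := spectrum.notMem_iff.1 hz
  have hφu : algebraMap ℂ B z - φ x = Units.map φ.toMonoidHom u := by simp [hu]
  rw [resolvent, resolvent, hφu, ← hu, Ring.inverse_unit, Ring.inverse_unit]
  rfl

variable [CompleteSpace A] [CompleteSpace B]

theorem SurroundingCycle.intervalIntegrable_smul_resolvent {K U : Set ℂ} (Γ : SurroundingCycle K U)
    {x : A} (hK : spectrum ℂ x ⊆ K) {f : ℂ → ℂ} (hf : ContinuousOn f U) (j : Fin Γ.card) :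
    IntervalIntegrable (fun t => (f (Γ.path j t) * deriv (Γ.path j) t) • resolvent x (Γ.path j t))
      MeasureTheory.volume 0 1 := by
  have hpath : ContinuousOn (Γ.path j) (Icc 0 1) := (Γ.contDiff j).continuous.continuousOn
  have hresolvent : ContinuousOn (resolvent x) (spectrum ℂ x)ᶜ := fun z hz =>
    (spectrum.hasDerivAt_resolvent_const_left
      (spectrum.notMem_iff.1 hz)).continuousAt.continuousWithinAt
  refine ContinuousOn.intervalIntegrable_of_Icc zero_le_one (.smul (.mul ?_ ?_) ?_)
  · exact hf.comp hpath fun t ht => (Γ.mem j t ht).1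
  · exact ((Γ.contDiff j).continuous_deriv le_rfl).continuousOn
  · exact hresolvent.comp hpath fun t ht h => (Γ.mem j t ht).2 (hK h)

theorem map_dunfordIntegral (φ : A →ₐ[ℂ] B) (hφ : Continuous φ) {K U : Set ℂ}
    (Γ : SurroundingCycle K U) {x : A} (hK : spectrum ℂ x ⊆ K) {f : ℂ → ℂ}
    (hf : ContinuousOn f U) :
    φ (dunfordIntegral f Γ x) = dunfordIntegral f Γ (φ x) := by
  let φL : A →L[ℂ] B := ⟨φ.toLinearMap, hφ⟩
  have hφL : ⇑φL = φ := rfl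
  rw [dunfordIntegral, dunfordIntegral, ← hφL, map_smul, map_sum]
  congr 1
  refine Finset.sum_congr rfl fun j _ => ?_
  rw [← φL.intervalIntegral_comp_comm (Γ.intervalIntegrable_smul_resolvent hK hf j)]
  refine intervalIntegral.integral_congr fun t ht => ?_
  rw [uIcc_of_le zero_le_one] at ht
  simp only [map_smul, hφL, map_resolvent φ fun h => (Γ.mem j t ht).2 (hK h)]

end HolomorphicCalculus

/-- A norm with values in `[0, ∞]` on a Banach algebra that dominates the given norm, is
submultiplicative and countably subadditive; the elements where it is finite form a Banach algebra
of their own. -/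
structure AlgebraGauge (B : Type*) [NormedRing B] [NormedAlgebra ℂ B] where
  toFun : B → ℝ≥0∞
  enorm_le : ∀ x, ‖x‖ₑ ≤ toFun x
  one_ne_top : toFun 1 ≠ ⊤
  smul_le : ∀ (a : ℂ) (x : B), toFun (a • x) ≤ ‖a‖ₑ * toFun x
  mul_le : ∀ x y, toFun (x * y) ≤ toFun x * toFun y
  hasSum_le : ∀ {ι : Type} [Countable ι] {f : ι → B} {x : B}, HasSum f x →
    toFun x ≤ ∑' i, toFun (f i)

namespace AlgebraGauge

variable {B : Type*} [NormedRing B] [NormedAlgebra ℂ B] (N : AlgebraGauge B)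

instance : CoeFun (AlgebraGauge B) fun _ => B → ℝ≥0∞ := ⟨toFun⟩

theorem zero : N 0 = 0 := by
  simpa using N.smul_le 0 0

theorem add_le (x y : B) : N (x + y) ≤ N x + N y := by
  simpa using N.hasSum_le (hasSum_fintype fun b : Bool => cond b x y)

theorem neg (x : B) : N (-x) = N x := by
  have neg_le (y : B) : N (-y) ≤ N y := by simpa using N.smul_le (-1) y
  exact (neg_le x).antisymm (by simpa using neg_le (-x))

/-- The restriction of a gauge along an isometric homomorphism. -/
def comap {A : Type*} [NormedRing A] [NormedAlgebra ℂ A] (φ : A →ₐ[ℂ] B) (hφ : Isometry φ) :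
    AlgebraGauge A where
  toFun x := N (φ x)
  enorm_le x := by
    rw [← ofReal_norm, ← (AddMonoidHomClass.isometry_iff_norm φ).1 hφ x, ofReal_norm]
    exact N.enorm_le _
  one_ne_top := by simpa using N.one_ne_top
  smul_le a x := by simpa using N.smul_le a (φ x)
  mul_le x y := by simpa using N.mul_le (φ x) (φ y)
  hasSum_le h := N.hasSum_le (h.map φ hφ.continuous)

/-- The subalgebra where a gauge is finite. -/
def finite : Subalgebra ℂ B where
  carrier := {x | N x ≠ ⊤}
  mul_mem' hx hy := ne_top_of_le_ne_top (ENNReal.mul_ne_top hx hy) (N.mul_le _ _)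
  add_mem' hx hy := ne_top_of_le_ne_top (ENNReal.add_ne_top.2 ⟨hx, hy⟩) (N.add_le _ _)
  algebraMap_mem' a := by
    rw [Algebra.algebraMap_eq_smul_one]
    exact ne_top_of_le_ne_top (ENNReal.mul_ne_top enorm_ne_top N.one_ne_top) (N.smul_le _ _)

theorem mem_finite {x : B} : x ∈ N.finite ↔ N x ≠ ⊤ := Iff.rfl

theorem hasSum_mem_finite {ι : Type} [Countable ι] {f : ι → B} {x : B} (hf : HasSum f x)
    (h : ∑' i, N (f i) ≠ ⊤) : x ∈ N.finite :=
  N.mem_finite.2 (ne_top_of_le_ne_top h (N.hasSum_le hf))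

/-- The subalgebra `N.finite` as a type of its own, which carries the norm given by the gauge
instead of the one induced from `B`. -/
def FinitePart : Type _ := N.finite

namespace FinitePart

instance : Ring N.FinitePart := inferInstanceAs (Ring N.finite)

instance : Algebra ℂ N.FinitePart := inferInstanceAs (Algebra ℂ N.finite)

/-- The inclusion of the elements with finite gauge. -/
def val : N.FinitePart →ₐ[ℂ] B := N.finite.val

variable {N}

theorem val_injective : Function.Injective (val N) := Subtype.val_injective

theorem gauge_ne_top (x : N.FinitePart) : N (val N x) ≠ ⊤ := x.2

theorem norm_val_le (x : N.FinitePart) : ‖val N x‖ ≤ (N (val N x)).toReal := by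
  rw [← toReal_enorm]
  exact ENNReal.toReal_mono x.gauge_ne_top (N.enorm_le _)

instance : NormedRing N.FinitePart := RingNorm.toNormedRing
  { toFun := fun x => (N (val N x)).toReal
    map_zero' := by simp [N.zero]
    add_le' := fun x y => by
      rw [map_add, ← ENNReal.toReal_add x.gauge_ne_top y.gauge_ne_top]
      exact ENNReal.toReal_mono (ENNReal.add_ne_top.2 ⟨x.gauge_ne_top, y.gauge_ne_top⟩)
        (N.add_le _ _)
    neg' := fun x => by rw [map_neg, N.neg]
    mul_le' := fun x y => by
      rw [map_mul, ← ENNReal.toReal_mul]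
      exact ENNReal.toReal_mono (ENNReal.mul_ne_top x.gauge_ne_top y.gauge_ne_top)
        (N.mul_le _ _)
    eq_zero_of_map_eq_zero' := fun x hx => val_injective <| by
      rw [map_zero, ← norm_le_zero_iff]
      exact (norm_val_le x).trans hx.le }

theorem norm_def (x : N.FinitePart) : ‖x‖ = (N (val N x)).toReal := rfl

theorem enorm_eq (x : N.FinitePart) : ‖x‖ₑ = N (val N x) := by
  rw [← ofReal_norm, norm_def, ENNReal.ofReal_toReal x.gauge_ne_top]

instance : NormedAlgebra ℂ N.FinitePart where
  norm_smul_le a x := by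
    rw [norm_def, norm_def, map_smul, ← toReal_enorm a, ← ENNReal.toReal_mul]
    exact ENNReal.toReal_mono (ENNReal.mul_ne_top enorm_ne_top x.gauge_ne_top) (N.smul_le _ _)

theorem continuous_val : Continuous (val N) :=
  AddMonoidHomClass.continuous_of_bound (val N) 1 fun x =>
    (norm_val_le x).trans_eq (one_mul _).symm

instance [CompleteSpace B] : CompleteSpace N.FinitePart := by
  refine NormedAddCommGroup.completeSpace_of_summable_imp_tendsto fun u hu => ?_
  have summable_val : Summable fun n => val N (u n) :=
    .of_norm_bounded hu fun n => norm_val_le (u n)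
  have enorm_summable : ∑' i, ‖u i‖ₑ ≠ ⊤ := by
    simpa only [ofReal_norm] using hu.tsum_ofReal_ne_top
  let a : N.FinitePart := ⟨∑' n, val N (u n), N.hasSum_mem_finite summable_val.hasSum
    (by simpa only [enorm_eq] using enorm_summable)⟩
  have enorm_tail_le (n : ℕ) : ‖a - ∑ i ∈ Finset.range n, u i‖ₑ ≤ ∑' i, ‖u (i + n)‖ₑ := by
    simp only [enorm_eq, map_sub, map_sum]
    exact N.hasSum_le ((hasSum_nat_add_iff' n).2 summable_val.hasSum)
  refine ⟨a, tendsto_iff_edist_tendsto_0.2 ?_⟩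
  simp only [edist_comm _ a, edist_eq_enorm_sub]
  exact tendsto_of_tendsto_of_tendsto_of_le_of_le tendsto_const_nhds
    (ENNReal.tendsto_sum_nat_add _ enorm_summable) (fun _ => zero_le) enorm_tail_le

theorem mul_eq_one_of_val {x y : N.FinitePart} (h : val N x * val N y = 1) : x * y = 1 :=
  val_injective (by simpa using h)

end FinitePart

/-- The resolvent of `x` in `B` lies in each of the Banach algebras `(N p).FinitePart`, so these
contain the Dunford integrals. -/
theorem stableUnderHolomorphicCalculus_iInf_finite [CompleteSpace B] {ι : Type*}
    (N : ι → AlgebraGauge B)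
    (inv_mem : ∀ x ∈ ⨅ p, (N p).finite, ∀ y, x * y = 1 → y * x = 1 → y ∈ ⨅ p, (N p).finite) :
    StableUnderHolomorphicCalculus (⨅ p, (N p).finite) := by
  intro x hx U _ _ f hf Γ
  refine Algebra.mem_iInf.2 fun p => ?_
  let x' : (N p).FinitePart := ⟨x, Algebra.mem_iInf.1 hx p⟩
  have spectrum_subset : spectrum ℂ x' ⊆ spectrum ℂ x := fun z => by
    contrapose!
    intro hz
    obtain ⟨u, hu⟩ : IsUnit (algebraMap ℂ B z - x) := spectrum.notMem_iff.1 hz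
    have sub_mem : algebraMap ℂ B z - x ∈ ⨅ p, (N p).finite :=
      sub_mem (Subalgebra.algebraMap_mem _ z) hx
    have mul_inv : (algebraMap ℂ B z - x) * ↑u⁻¹ = 1 := by rw [← hu, Units.mul_inv]
    have inv_mul : ↑u⁻¹ * (algebraMap ℂ B z - x) = 1 := by rw [← hu, Units.inv_mul]
    let y : (N p).FinitePart :=
      ⟨↑u⁻¹, Algebra.mem_iInf.1 (inv_mem _ sub_mem _ mul_inv inv_mul) p⟩
    exact spectrum.notMem_iff.2 <| isUnit_iff_exists.2
      ⟨y, FinitePart.mul_eq_one_of_val mul_inv, FinitePart.mul_eq_one_of_val inv_mul⟩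
  have key := map_dunfordIntegral (FinitePart.val (N p)) FinitePart.continuous_val Γ
    spectrum_subset hf.continuousOn
  exact key ▸ FinitePart.gauge_ne_top _

end AlgebraGauge

/-! ### Atomic norms -/

section AtomicNorm

variable {ι B : Type*} [NormedRing B] [NormedAlgebra ℂ B] {X : ι → B} {w : ι → ℝ≥0∞}

/-- The least cost `∑ |c i| w i` of an expansion `x = ∑ c i • X i` into the atoms `X i` of
weights `w i`, which is `⊤` if there is no such expansion. -/
def atomicNorm (X : ι → B) (w : ι → ℝ≥0∞) (x : B) : ℝ≥0∞ :=
  ⨅ (c : ι → ℂ) (_ : HasSum (fun i => c i • X i) x), ∑' i, ‖c i‖ₑ * w i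

theorem atomicNorm_le {c : ι → ℂ} {x : B} (h : HasSum (fun i => c i • X i) x) :
    atomicNorm X w x ≤ ∑' i, ‖c i‖ₑ * w i :=
  iInf₂_le c h

theorem exists_hasSum_of_atomicNorm_lt {x : B} {r : ℝ≥0∞} (h : atomicNorm X w x < r) :
    ∃ c : ι → ℂ, HasSum (fun i => c i • X i) x ∧ ∑' i, ‖c i‖ₑ * w i < r := by
  simpa only [atomicNorm, iInf_lt_iff, exists_prop] using h

theorem atomicNorm_atom_le (i : ι) : atomicNorm X w (X i) ≤ w i := by
  classical
  have hasSum_atom : HasSum (fun j => Pi.single (M := fun _ => ℂ) i 1 j • X j) (X i) := by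
    simpa using hasSum_single (f := fun j => Pi.single (M := fun _ => ℂ) i 1 j • X j) i
      fun j hj => by simp [hj]
  refine (atomicNorm_le hasSum_atom).trans_eq ?_
  rw [tsum_eq_single i fun j hj => by simp [hj]]
  simp

theorem atomicNorm_zero : atomicNorm X w 0 = 0 := by
  have hasSum_zero_smul : HasSum (fun i => (0 : ι → ℂ) i • X i) 0 := by
    simp [hasSum_zero]
  simpa using atomicNorm_le (w := w) hasSum_zero_smul

theorem atomicNorm_smul_le (a : ℂ) (x : B) :
    atomicNorm X w (a • x) ≤ ‖a‖ₑ * atomicNorm X w x := by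
  rcases eq_or_ne a 0 with rfl | ha
  · simp [atomicNorm_zero]
  refine ENNReal.le_mul_of_forall_lt (.inl (by simpa)) (.inl enorm_ne_top) fun r hr s hs => ?_
  obtain ⟨c, hc, cost⟩ := exists_hasSum_of_atomicNorm_lt hs
  have hasSum_smul : HasSum (fun i => (a * c i) • X i) (a • x) := by
    simpa only [mul_smul] using hc.const_smul a
  calc atomicNorm X w (a • x) ≤ ∑' i, ‖a * c i‖ₑ * w i := atomicNorm_le hasSum_smul
    _ = ‖a‖ₑ * ∑' i, ‖c i‖ₑ * w i := by
      simp only [enorm_mul, mul_assoc, ENNReal.tsum_mul_left]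
    _ ≤ r * s := mul_le_mul' hr.le cost.le

theorem enorm_le_atomicNorm (hX : ∀ i, ‖X i‖ₑ ≤ 1) (hw : ∀ i, 1 ≤ w i) (x : B) :
    ‖x‖ₑ ≤ atomicNorm X w x := by
  refine le_iInf₂ fun c hc => ?_
  rw [← hc.tsum_eq]
  refine enorm_tsum_le_tsum_enorm.trans (ENNReal.tsum_le_tsum fun i => ?_)
  rw [enorm_smul]
  gcongr
  exact (hX i).trans (hw i)

theorem summable_norm_smul_of_tsum_ne_top (hX : ∀ i, ‖X i‖ₑ ≤ w i) {c : ι → ℂ}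
    (h : ∑' i, ‖c i‖ₑ * w i ≠ ⊤) : Summable fun i => ‖c i • X i‖ := by
  refine tsum_enorm_ne_top_iff_summable_norm.1 (ne_top_of_le_ne_top h ?_)
  simp only [enorm_smul]
  exact ENNReal.tsum_le_tsum fun i => mul_le_mul_right (hX i) _

variable [CompleteSpace B]

theorem atomicNorm_hasSum_le (hX : ∀ i, ‖X i‖ₑ ≤ 1) (hw : ∀ i, 1 ≤ w i) {κ : Type*} [Countable κ]
    {f : κ → B} {x : B} (hf : HasSum f x) :
    atomicNorm X w x ≤ ∑' j, atomicNorm X w (f j) := by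
  refine ENNReal.le_of_forall_pos_le_add fun ε hε hfin => ?_
  obtain ⟨δ, hδ, hδε⟩ :=
    ENNReal.exists_pos_sum_of_countable' (ENNReal.coe_pos.2 hε).ne' κ
  have lt_add (j : κ) : atomicNorm X w (f j) < atomicNorm X w (f j) + δ j :=
    ENNReal.lt_add_right (ENNReal.ne_top_of_tsum_ne_top hfin.ne j) (hδ j).ne'
  choose c hasSum_c cost_c using fun j => exists_hasSum_of_atomicNorm_lt (lt_add j)
  have cost_le : ∑' j, ∑' i, ‖c j i‖ₑ * w i ≤ ∑' j, atomicNorm X w (f j) + ε := by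
    refine (ENNReal.tsum_le_tsum fun j => (cost_c j).le).trans ?_
    rw [ENNReal.tsum_add]
    gcongr
  have cost_ne_top : ∑' q : κ × ι, ‖c q.1 q.2‖ₑ * w q.2 ≠ ⊤ := by
    rw [ENNReal.tsum_prod (f := fun j i => ‖c j i‖ₑ * w i)]
    exact ne_top_of_le_ne_top (ENNReal.add_ne_top.2 ⟨hfin.ne, ENNReal.coe_ne_top⟩) cost_le
  have summable_terms : Summable fun q : κ × ι => c q.1 q.2 • X q.2 :=
    .of_norm <| summable_norm_smul_of_tsum_ne_top (X := fun q : κ × ι => X q.2)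
      (w := fun q => w q.2) (fun q => (hX q.2).trans (hw q.2)) cost_ne_top
  have hasSum_terms : HasSum (fun q : κ × ι => c q.1 q.2 • X q.2) x :=
    (summable_terms.hasSum.prod_fiberwise hasSum_c).unique hf ▸ summable_terms.hasSum
  have summable_coeff (i : ι) : Summable fun j => c j i := by
    have h : ∑' j, ‖c j i‖ₑ ≠ ⊤ := ne_top_of_le_ne_top cost_ne_top <| by
      rw [ENNReal.tsum_prod (f := fun j i => ‖c j i‖ₑ * w i)]
      exact ENNReal.tsum_le_tsum fun j => (le_mul_of_one_le_right' (hw i)).trans (ENNReal.le_tsum i)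
    exact .of_norm (tsum_enorm_ne_top_iff_summable_norm.1 h)
  have hasSum_coeff : HasSum (fun i => (∑' j, c j i) • X i) x :=
    ((Equiv.prodComm ι κ).hasSum_iff.2 hasSum_terms).prod_fiberwise
      fun i => (summable_coeff i).hasSum.smul_const (X i)
  calc atomicNorm X w x ≤ ∑' i, ‖∑' j, c j i‖ₑ * w i := atomicNorm_le hasSum_coeff
    _ ≤ ∑' i, ∑' j, ‖c j i‖ₑ * w i := ENNReal.tsum_le_tsum fun i => by
        rw [ENNReal.tsum_mul_right]
        gcongr
        exact enorm_tsum_le_tsum_enorm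
    _ = ∑' j, ∑' i, ‖c j i‖ₑ * w i := ENNReal.tsum_comm
    _ ≤ ∑' j, atomicNorm X w (f j) + ε := cost_le

theorem atomicNorm_le_of_hasSum_smul (hX : ∀ i, ‖X i‖ₑ ≤ 1) (hw : ∀ i, 1 ≤ w i)
    {κ : Type*} [Countable κ] {a : κ → ℂ} {f : κ → B} {x : B} (hf : HasSum (fun j => a j • f j) x) :
    atomicNorm X w x ≤ ∑' j, ‖a j‖ₑ * atomicNorm X w (f j) :=
  (atomicNorm_hasSum_le hX hw hf).trans
    (ENNReal.tsum_le_tsum fun j => atomicNorm_smul_le (a j) (f j))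

theorem atomicNorm_sub_le (hX : ∀ i, ‖X i‖ₑ ≤ 1) (hw : ∀ i, 1 ≤ w i) (x y : B) :
    atomicNorm X w (x - y) ≤ atomicNorm X w x + atomicNorm X w y := by
  have hasSum_sub := hasSum_fintype fun b : Bool => (cond b 1 (-1) : ℂ) • cond b x y
  simpa [tsum_fintype, sub_eq_add_neg] using atomicNorm_le_of_hasSum_smul hX hw hasSum_sub

theorem atomicNorm_sum_le (hX : ∀ i, ‖X i‖ₑ ≤ 1) (hw : ∀ i, 1 ≤ w i) {κ : Type*} (s : Finset κ)
    (f : κ → B) : atomicNorm X w (∑ j ∈ s, f j) ≤ ∑ j ∈ s, atomicNorm X w (f j) :=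
  (atomicNorm_hasSum_le hX hw (s.hasSum f)).trans_eq (s.tsum_subtype fun j => atomicNorm X w (f j))

theorem atomicNorm_mul_le_of_hasSum [Countable ι]
    (hX : ∀ i, ‖X i‖ₑ ≤ 1) (hw : ∀ i, 1 ≤ w i)
    (hmul : ∀ i j, atomicNorm X w (X i * X j) ≤ w i * w j) {c d : ι → ℂ} {x y : B}
    (hc : HasSum (fun i => c i • X i) x) (hd : HasSum (fun i => d i • X i) y)
    (cost_c : ∑' i, ‖c i‖ₑ * w i ≠ ⊤) (cost_d : ∑' i, ‖d i‖ₑ * w i ≠ ⊤) :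
    atomicNorm X w (x * y) ≤ (∑' i, ‖c i‖ₑ * w i) * ∑' i, ‖d i‖ₑ * w i := by
  have norm_c := summable_norm_smul_of_tsum_ne_top (fun i => (hX i).trans (hw i)) cost_c
  have norm_d := summable_norm_smul_of_tsum_ne_top (fun i => (hX i).trans (hw i)) cost_d
  have summable_mul := summable_mul_of_summable_norm norm_c norm_d
  have hasSum_mul : HasSum (fun q : ι × ι => (c q.1 * d q.2) • (X q.1 * X q.2)) (x * y) := by
    simpa only [smul_mul_smul_comm] using hc.mul hd summable_mul
  calc atomicNorm X w (x * y)
      ≤ ∑' q : ι × ι, ‖c q.1 * d q.2‖ₑ * atomicNorm X w (X q.1 * X q.2) :=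
        atomicNorm_le_of_hasSum_smul hX hw hasSum_mul
    _ ≤ ∑' q : ι × ι, (‖c q.1‖ₑ * w q.1) * (‖d q.2‖ₑ * w q.2) :=
        ENNReal.tsum_le_tsum fun q => by
          rw [mul_mul_mul_comm, ← enorm_mul]
          exact mul_le_mul_right (hmul q.1 q.2) _
    _ = (∑' i, ‖c i‖ₑ * w i) * ∑' i, ‖d i‖ₑ * w i := by
        rw [ENNReal.tsum_prod']
        simp only [ENNReal.tsum_mul_left, ENNReal.tsum_mul_right]

theorem atomicNorm_mul_le [Countable ι]
    (hX : ∀ i, ‖X i‖ₑ ≤ 1) (hw : ∀ i, 1 ≤ w i)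
    (hmul : ∀ i j, atomicNorm X w (X i * X j) ≤ w i * w j) (x y : B) :
    atomicNorm X w (x * y) ≤ atomicNorm X w x * atomicNorm X w y := by
  rcases eq_or_ne x 0 with rfl | hx
  · simp [atomicNorm_zero]
  rcases eq_or_ne y 0 with rfl | hy
  · simp [atomicNorm_zero]
  have ne_zero {z : B} (hz : z ≠ 0) : atomicNorm X w z ≠ 0 := fun h =>
    hz (enorm_eq_zero.1 (le_zero_iff.1 (h ▸ enorm_le_atomicNorm hX hw z)))
  refine ENNReal.le_mul_of_forall_lt (.inl (ne_zero hx)) (.inr (ne_zero hy)) fun r hr s hs => ?_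
  obtain ⟨c, hc, cost_c⟩ := exists_hasSum_of_atomicNorm_lt hr
  obtain ⟨d, hd, cost_d⟩ := exists_hasSum_of_atomicNorm_lt hs
  exact (atomicNorm_mul_le_of_hasSum hX hw hmul hc hd cost_c.ne_top cost_d.ne_top).trans
    (mul_le_mul' cost_c.le cost_d.le)

/-- The atomic norm of a system of atoms whose products are controlled by their weights. -/
def AlgebraGauge.atomic [Countable ι] (X : ι → B) (w : ι → ℝ≥0∞) (hX : ∀ i, ‖X i‖ₑ ≤ 1)
    (hw : ∀ i, 1 ≤ w i) (hone : atomicNorm X w 1 ≠ ⊤)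
    (hmul : ∀ i j, atomicNorm X w (X i * X j) ≤ w i * w j) : AlgebraGauge B where
  toFun := atomicNorm X w
  enorm_le := enorm_le_atomicNorm hX hw
  one_ne_top := hone
  smul_le := atomicNorm_smul_le
  mul_le := atomicNorm_mul_le hX hw hmul
  hasSum_le := atomicNorm_hasSum_le hX hw

end AtomicNorm

theorem hasSum_smul_mul_mul {ι κ B : Type*} [NormedRing B] [CompleteSpace B] [NormedAlgebra ℂ B]
    {X : ι → B} {X' : κ → B} {d : ι → ℂ} {d' : κ → ℂ} {r r' : B}
    (hd : Summable fun i => ‖d i • X i‖) (hd' : Summable fun k => ‖d' k • X' k‖)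
    (hr : HasSum (fun i => d i • X i) r) (hr' : HasSum (fun k => d' k • X' k) r') (y : B) :
    HasSum (fun q : ι × κ => (d q.1 * d' q.2) • (X q.1 * y * X' q.2)) (r * y * r') := by
  have hasSum_mul_right : HasSum (fun i => d i • (X i * y)) (r * y) := by
    simpa only [smul_mul_assoc] using hr.mul_right y
  have summable_mul_right : Summable fun i => ‖d i • (X i * y)‖ :=
    (hd.mul_right ‖y‖).of_nonneg_of_le (fun _ => norm_nonneg _) fun i => by
      rw [← smul_mul_assoc]
      exact norm_mul_le _ _
  have summable_mul := summable_mul_of_summable_norm summable_mul_right hd'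
  simpa only [smul_mul_smul_comm] using hasSum_mul_right.mul hr' summable_mul

/-! ### Rapidly decreasing families -/

section RapidlyDecreasing

variable {ι κ E : Type*} [NormedAddCommGroup E]

/-- Families `c` that decrease faster than every power of the size `s` of the index. -/
def RapidlyDecreasing (s : ι → ℕ) (c : ι → E) : Prop :=
  ∀ p : ℕ, ∃ C : ℝ, ∀ i, (s i : ℝ) ^ p * ‖c i‖ ≤ C

/-- Sizes `s ≥ 1` for which some inverse power is summable, so that rapid decay in the sense of
suprema and of weighted `ℓ¹` norms is the same. -/
structure IsTempered (s : ι → ℕ) : Prop where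
  one_le : ∀ i, 1 ≤ s i
  exists_summable : ∃ q : ℕ, Summable fun i => ((s i : ℝ) ^ q)⁻¹

theorem isTempered_nat : IsTempered fun k : ℕ => 1 + k where
  one_le k := by omega
  exists_summable := ⟨2, by
    have := (summable_nat_add_iff 1).2 (Real.summable_nat_pow_inv (p := 2).2 one_lt_two)
    simpa only [add_comm 1] using this⟩

theorem isTempered_int : IsTempered fun n : ℤ => 1 + n.natAbs where
  one_le k := by omega
  exists_summable := ⟨2, by
    have h := (summable_nat_add_iff 1).2 (Real.summable_nat_pow_inv (p := 2).2 one_lt_two)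
    simp only [add_comm _ 1] at h
    exact .of_nat_of_neg (by simpa using h) (by simpa using h)⟩

theorem IsTempered.prod {s : ι → ℕ} {t : κ → ℕ} {u : ι × κ → ℕ} (hs : IsTempered s)
    (ht : IsTempered t) (hsu : ∀ q, s q.1 ≤ u q) (htu : ∀ q, t q.2 ≤ u q) : IsTempered u where
  one_le q := (hs.one_le q.1).trans (hsu q)
  exists_summable := by
    obtain ⟨a, ha⟩ := hs.exists_summable
    obtain ⟨b, hb⟩ := ht.exists_summable
    refine ⟨a + b, .of_nonneg_of_le (fun q => by positivity) (fun q => ?_)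
      (ha.mul_of_nonneg hb (fun i => by positivity) fun j => by positivity)⟩
    have hs' : (0 : ℝ) < s q.1 := by exact_mod_cast hs.one_le q.1
    have ht' : (0 : ℝ) < t q.2 := by exact_mod_cast ht.one_le q.2
    rw [← mul_inv, pow_add]
    gcongr
    exacts [hsu q, htu q]

theorem IsTempered.sumElim {s : ι → ℕ} {t : κ → ℕ} (hs : IsTempered s) (ht : IsTempered t) :
    IsTempered (Sum.elim s t) where
  one_le := Sum.forall.2 ⟨hs.one_le, ht.one_le⟩
  exists_summable := by
    obtain ⟨a, ha⟩ := hs.exists_summable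
    obtain ⟨b, hb⟩ := ht.exists_summable
    have inv_le {n : ℕ} (hn : 1 ≤ n) {q : ℕ} (hq : q ≤ a + b) :
        ((n : ℝ) ^ (a + b))⁻¹ ≤ ((n : ℝ) ^ q)⁻¹ := by
      have : (1 : ℝ) ≤ n := by exact_mod_cast hn
      gcongr
    have inv_nonneg (n : ℕ) : 0 ≤ ((n : ℝ) ^ (a + b))⁻¹ := by positivity
    exact ⟨a + b, Summable.sum _
      (.of_nonneg_of_le (fun _ => inv_nonneg _) (fun i => inv_le (hs.one_le i) (by omega)) ha)
      (.of_nonneg_of_le (fun _ => inv_nonneg _) (fun j => inv_le (ht.one_le j) (by omega)) hb)⟩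

theorem RapidlyDecreasing.comp {s : ι → ℕ} {c : ι → E} (hc : RapidlyDecreasing s c) {t : κ → ℕ}
    (g : κ → ι) (hg : ∀ j, t j ≤ s (g j)) : RapidlyDecreasing t fun j => c (g j) := fun p => by
  obtain ⟨C, hC⟩ := hc p
  refine ⟨C, fun j => (hC (g j)).trans' ?_⟩
  gcongr
  exact hg j

theorem rapidlyDecreasing_sum {s : ι → ℕ} {t : κ → ℕ} {c : ι ⊕ κ → E} :
    RapidlyDecreasing (Sum.elim s t) c ↔
      (RapidlyDecreasing s fun i => c (.inl i)) ∧ RapidlyDecreasing t fun j => c (.inr j) := by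
  refine ⟨fun h => ⟨h.comp _ fun _ => le_rfl, h.comp _ fun _ => le_rfl⟩, fun ⟨h₁, h₂⟩ p => ?_⟩
  obtain ⟨C, hC⟩ := h₁ p
  obtain ⟨D, hD⟩ := h₂ p
  exact ⟨max C D, Sum.forall.2 ⟨fun i => (hC i).trans (le_max_left _ _),
    fun j => (hD j).trans (le_max_right _ _)⟩⟩

theorem RapidlyDecreasing.exists_pow_mul_norm_le {s : ι → ℕ} (hs : ∀ i, 1 ≤ s i) {c : ι → E}
    (hc : RapidlyDecreasing s c) (p q : ℕ) :
    ∃ C : ℝ, ∀ i, (s i : ℝ) ^ p * ‖c i‖ ≤ C * ((s i : ℝ) ^ q)⁻¹ := by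
  obtain ⟨C, hC⟩ := hc (p + q)
  refine ⟨C, fun i => ?_⟩
  have hsi : (0 : ℝ) < s i := by exact_mod_cast hs i
  rw [← div_eq_mul_inv, le_div_iff₀ (by positivity), mul_right_comm, ← pow_add]
  exact hC i

theorem rapidlyDecreasing_iff_summable {s : ι → ℕ} (hs : IsTempered s) {c : ι → E} :
    RapidlyDecreasing s c ↔ ∀ p : ℕ, Summable fun i => (s i : ℝ) ^ p * ‖c i‖ := by
  refine ⟨fun h p => ?_, fun h p => ⟨_, fun i => (h p).le_tsum i fun j _ => by positivity⟩⟩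
  obtain ⟨q, hq⟩ := hs.exists_summable
  obtain ⟨C, hC⟩ := h.exists_pow_mul_norm_le hs.one_le p q
  exact .of_nonneg_of_le (fun i => by positivity) hC (hq.mul_left C)

theorem rapidlyDecreasing_iff_tsum_ne_top {s : ι → ℕ} (hs : IsTempered s) {c : ι → E} :
    RapidlyDecreasing s c ↔ ∀ p : ℕ, ∑' i, ‖c i‖ₑ * (s i : ℝ≥0∞) ^ p ≠ ⊤ := by
  rw [rapidlyDecreasing_iff_summable hs]
  refine forall_congr' fun p => ?_
  have enorm_term (i : ι) : ‖(s i : ℝ) ^ p * ‖c i‖‖ₑ = ‖c i‖ₑ * (s i : ℝ≥0∞) ^ p := by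
    rw [enorm_mul, enorm_norm, enorm_pow, mul_comm, Real.enorm_natCast]
  rw [← summable_norm_iff, ← tsum_enorm_ne_top_iff_summable_norm]
  simp only [enorm_term]

theorem IsTempered.exists_tsum_le {t : κ → ℕ} (ht : IsTempered t) {a : ι → κ → E}
    (ha : RapidlyDecreasing (fun q : ι × κ => t q.2) fun q => a q.1 q.2) (p : ℕ) :
    ∃ C : ℝ≥0∞, C ≠ ⊤ ∧ ∀ i, ∑' k, ‖a i k‖ₑ * (t k : ℝ≥0∞) ^ p ≤ C := by
  obtain ⟨q, hq⟩ := ht.exists_summable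
  obtain ⟨C, hC⟩ := ha.exists_pow_mul_norm_le (fun i : ι × κ => ht.one_le i.2) p q
  refine ⟨∑' k, ‖C * ((t k : ℝ) ^ q)⁻¹‖ₑ,
    tsum_enorm_ne_top_iff_summable_norm.2 (hq.mul_left C).norm, fun i =>
    ENNReal.tsum_le_tsum fun k => ?_⟩
  rw [← Real.enorm_natCast, ← enorm_norm (a i k), ← enorm_pow, ← enorm_mul,
    enorm_le_iff_norm_le, Real.norm_of_nonneg (by positivity), mul_comm]
  exact (hC (i, k)).trans (le_abs_self _)

theorem RapidlyDecreasing.summable_norm {s : ι → ℕ} (hs : IsTempered s) {c : ι → E}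
    (hc : RapidlyDecreasing s c) : Summable fun i => ‖c i‖ := by
  simpa using (rapidlyDecreasing_iff_summable hs).1 hc 0

theorem RapidlyDecreasing.summable_abs_pow_mul_norm {s : ι → ℕ} (hs : IsTempered s) {c : ι → E}
    (hc : RapidlyDecreasing s c) {n : ι → ℤ} (hn : ∀ i, (n i).natAbs ≤ s i) (p : ℕ) :
    Summable fun i => |(n i : ℝ)| ^ p * ‖c i‖ := by
  refine .of_nonneg_of_le (fun i => by positivity) (fun i => ?_)
    ((rapidlyDecreasing_iff_summable hs).1 hc p)
  rw [← Int.cast_abs, Int.abs_eq_natAbs, Int.cast_natCast]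
  gcongr
  exact hn i

theorem one_add_natAbs_pow_mul_le {n : ℤ} {x C D : ℝ} {p : ℕ} (hx : 0 ≤ x) (hC : x ≤ C)
    (hD : |(n : ℝ)| ^ p * x ≤ D) : ((1 + n.natAbs : ℕ) : ℝ) ^ p * x ≤ 2 ^ (p - 1) * (C + D) := by
  have cast_eq : ((1 + n.natAbs : ℕ) : ℝ) = 1 + |(n : ℝ)| := by
    push_cast [Nat.cast_natAbs]
    rfl
  calc ((1 + n.natAbs : ℕ) : ℝ) ^ p * x ≤ 2 ^ (p - 1) * (1 ^ p + |(n : ℝ)| ^ p) * x := by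
        rw [cast_eq]
        gcongr
        exact add_pow_le zero_le_one (abs_nonneg _) p
    _ = 2 ^ (p - 1) * (x + |(n : ℝ)| ^ p * x) := by ring
    _ ≤ 2 ^ (p - 1) * (C + D) := by gcongr

end RapidlyDecreasing

/-! ### Fourier series -/

section Fourier

/-- The character `θ ↦ exp (i n θ)` of the circle `ℝ / 2πℤ`. -/
def chr (n : ℤ) (θ : ℝ) : ℂ := fourier n (θ : AddCircle (2 * Real.pi))

theorem chr_apply (n : ℤ) (θ : ℝ) : chr n θ = Complex.exp (Complex.I * n * θ) := by
  have : (Real.pi : ℂ) ≠ 0 := by exact_mod_cast Real.pi_ne_zero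
  rw [chr, fourier_coe_apply]
  congr 1
  push_cast
  field_simp

theorem norm_chr (n : ℤ) (θ : ℝ) : ‖chr n θ‖ = 1 := Circle.norm_coe _

theorem chr_zero (θ : ℝ) : chr 0 θ = 1 := fourier_zero

theorem chr_add (m n : ℤ) (θ : ℝ) : chr (m + n) θ = chr m θ * chr n θ := fourier_add

theorem chr_pow (n : ℤ) (j : ℕ) (θ : ℝ) : chr n θ ^ j = chr (j * n) θ := by
  rw [chr_apply, chr_apply, ← Complex.exp_nat_mul]
  push_cast
  congr 1
  ring

theorem hasDerivAt_chr (n : ℤ) (θ : ℝ) : HasDerivAt (chr n) (Complex.I * n * chr n θ) θ := by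
  rw [funext (chr_apply n)]
  simpa only [Complex.ofRealCLM_apply, Complex.ofReal_one, mul_one, mul_comm] using!
    (Complex.ofRealCLM.hasDerivAt.const_mul (Complex.I * n)).cexp

theorem periodic_chr (n : ℤ) : Function.Periodic (chr n) (2 * Real.pi) := fun θ => by
  simp [chr]

theorem contDiff_chr (n : ℤ) : ContDiff ℝ ∞ (chr n) := by
  rw [funext (chr_apply n)]
  exact (contDiff_const.mul Complex.ofRealCLM.contDiff).cexp

variable {ι E : Type*} [NormedAddCommGroup E] [NormedSpace ℂ E]

theorem iteratedDeriv_chr_smul (n : ℤ) (v : E) (k : ℕ) :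
    iteratedDeriv k (fun θ => chr n θ • v) = fun θ => chr n θ • (Complex.I * n) ^ k • v := by
  induction k with
  | zero => simp
  | succ k ih =>
    ext θ
    rw [iteratedDeriv_succ, ih]
    refine ((hasDerivAt_chr n θ).smul_const _).deriv.trans ?_
    rw [smul_smul, smul_smul, pow_succ]
    ring_nf

theorem norm_iteratedFDeriv_chr_smul (n : ℤ) (v : E) (k : ℕ) (θ : ℝ) :
    ‖iteratedFDeriv ℝ k (fun θ => chr n θ • v) θ‖ = |(n : ℝ)| ^ k * ‖v‖ := by
  rw [norm_iteratedFDeriv_eq_norm_iteratedDeriv, iteratedDeriv_chr_smul]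
  simp [norm_smul, norm_chr, Complex.norm_intCast]

variable {n : ι → ℤ} {v : ι → E}

theorem contDiff_tsum_chr_smul [CompleteSpace E]
    (hv : ∀ p : ℕ, Summable fun i => |(n i : ℝ)| ^ p * ‖v i‖) :
    ContDiff ℝ ∞ fun θ => ∑' i, chr (n i) θ • v i :=
  contDiff_tsum (fun i => (contDiff_chr (n i)).smul contDiff_const) (fun k _ => hv k)
    fun k i θ _ => (norm_iteratedFDeriv_chr_smul (n i) (v i) k θ).le

theorem norm_iteratedDeriv_tsum_chr_smul_le [CompleteSpace E]
    (hv : ∀ p : ℕ, Summable fun i => |(n i : ℝ)| ^ p * ‖v i‖) (p : ℕ) (θ : ℝ) :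
    ‖iteratedDeriv p (fun θ => ∑' i, chr (n i) θ • v i) θ‖ ≤ ∑' i, |(n i : ℝ)| ^ p * ‖v i‖ := by
  have contDiff_term (i : ι) : ContDiff ℝ ∞ fun θ => chr (n i) θ • v i :=
    (contDiff_chr (n i)).smul contDiff_const
  rw [← norm_iteratedFDeriv_eq_norm_iteratedDeriv, iteratedFDeriv_tsum_apply (N := ⊤)
    contDiff_term (fun k _ => hv k)
    (fun k i θ _ => (norm_iteratedFDeriv_chr_smul (n i) (v i) k θ).le) le_top]
  exact tsum_of_norm_bounded (hv p).hasSum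
    fun i => (norm_iteratedFDeriv_chr_smul (n i) (v i) p θ).le

/-- The Fourier coefficients of a `2π`-periodic function of `θ`. -/
abbrev fourierCoeffTwoPi (f : ℝ → ℂ) (n : ℤ) : ℂ := fourierCoeffOn Real.two_pi_pos f n

theorem fourierCoeffTwoPi_eq_integral (f : ℝ → ℂ) (n : ℤ) : fourierCoeffTwoPi f n =
    (1 / (2 * Real.pi)) • ∫ θ in (0 : ℝ)..(2 * Real.pi), chr (-n) θ • f θ := by
  rw [fourierCoeffTwoPi, fourierCoeffOn_eq_integral, sub_zero]
  rfl

theorem fourierCoeffTwoPi_coe [Fact (0 < 2 * Real.pi)] (f : AddCircle (2 * Real.pi) → ℂ) (n : ℤ) :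
    fourierCoeffTwoPi (fun θ => f θ) n = fourierCoeff f n := by
  rw [fourierCoeffTwoPi_eq_integral, fourierCoeff_eq_intervalIntegral f n 0, zero_add]
  rfl

theorem fourierCoeffTwoPi_tsum_chr_smul {c : ℤ → ℂ} (hc : Summable fun n => ‖c n‖) (n : ℤ) :
    fourierCoeffTwoPi (fun θ => ∑' k, chr k θ • c k) n = c n := by
  have := Fact.mk Real.two_pi_pos
  have norm_term (k : ℤ) (t : AddCircle (2 * Real.pi)) :
      ‖fourier (-n) t • (c k * fourier k t)‖ = ‖c k‖ := by
    rw [norm_smul, norm_mul, fourier_apply, fourier_apply, Circle.norm_coe, Circle.norm_coe,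
      one_mul, mul_one]
  have integrable_term (k : ℤ) : MeasureTheory.Integrable
      (fun t : AddCircle (2 * Real.pi) => fourier (-n) t • (c k * fourier k t))
      AddCircle.haarAddCircle :=
    Continuous.integrable_of_hasCompactSupport (by fun_prop) (.of_compactSpace _)
  have coeff_term (k : ℤ) :
      fourierCoeff (fun t : AddCircle (2 * Real.pi) => c k * fourier k t) n =
        if k = n then c n else 0 := by
    rw [fourierCoeff.const_mul, fourierCoeff_fourier, Pi.single_apply]
    aesop
  have hasSum_coeff := MeasureTheory.hasSum_integral_of_summable_integral_norm integrable_term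
    (by
      simpa only [norm_term, MeasureTheory.integral_const, MeasureTheory.probReal_univ,
        one_smul] using hc)
  simp only [tsum_const_smul'', ← fourierCoeff.eq_1, coeff_term] at hasSum_coeff
  simp only [smul_eq_mul, mul_comm _ (c _), chr]
  rw [fourierCoeffTwoPi_coe fun t => ∑' k, c k * fourier k t]
  exact hasSum_coeff.unique (hasSum_ite_eq n _)

theorem norm_fourierCoeffTwoPi_le {f : ℝ → ℂ} {C : ℝ} (hf : ∀ θ, ‖f θ‖ ≤ C) (n : ℤ) :
    ‖fourierCoeffTwoPi f n‖ ≤ C := by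
  have hpi := Real.two_pi_pos
  have norm_integral_le := intervalIntegral.norm_integral_le_of_norm_le_const (a := 0)
    (b := 2 * Real.pi) (f := fun θ => chr (-n) θ • f θ) (C := C)
    fun θ _ => by rw [norm_smul, norm_chr, one_mul]; exact hf θ
  rw [sub_zero, abs_of_pos hpi] at norm_integral_le
  rw [fourierCoeffTwoPi_eq_integral, norm_smul, Real.norm_of_nonneg (by positivity)]
  calc _ ≤ 1 / (2 * Real.pi) * (C * (2 * Real.pi)) := by gcongr
    _ = C := by field_simp

theorem periodic_deriv {f : ℝ → E} {T : ℝ} (hf : Function.Periodic f T) :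
    Function.Periodic (deriv f) T := fun θ => by
  rw [← deriv_comp_add_const, funext hf]

theorem fourierCoeffTwoPi_deriv {f : ℝ → ℂ} (hf : ContDiff ℝ ∞ f)
    (hper : Function.Periodic f (2 * Real.pi)) (n : ℤ) :
    fourierCoeffTwoPi (deriv f) n = Complex.I * n * fourierCoeffTwoPi f n := by
  have eq_endpoint : f (2 * Real.pi) = f 0 := by simpa using hper 0
  have hderiv (θ : ℝ) : HasDerivAt f (deriv f θ) θ :=
    (hf.differentiable (by simp) θ).hasDerivAt
  have integrable_deriv : IntervalIntegrable (deriv f) MeasureTheory.volume 0 (2 * Real.pi) :=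
    (hf.continuous_deriv (by simp)).intervalIntegrable _ _
  rcases eq_or_ne n 0 with rfl | hn
  · rw [fourierCoeffTwoPi_eq_integral]
    simp only [neg_zero, chr_zero, one_smul]
    rw [intervalIntegral.integral_eq_sub_of_hasDerivAt (fun θ _ => hderiv θ) integrable_deriv,
      eq_endpoint]
    simp
  · have hpi : (Real.pi : ℂ) ≠ 0 := by exact_mod_cast Real.pi_ne_zero
    have hn' : (n : ℂ) ≠ 0 := by exact_mod_cast hn
    rw [fourierCoeffTwoPi, fourierCoeffTwoPi, fourierCoeffOn_of_hasDerivAt Real.two_pi_pos hn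
      (fun θ _ => hderiv θ) integrable_deriv, eq_endpoint]
    push_cast
    field_simp
    simp only [sub_self, mul_zero, zero_sub, neg_neg]
    ring

theorem abs_pow_mul_norm_fourierCoeffTwoPi_le {f : ℝ → ℂ} (hf : ContDiff ℝ ∞ f)
    (hper : Function.Periodic f (2 * Real.pi)) {p : ℕ} {C : ℝ}
    (hC : ∀ θ, ‖iteratedDeriv p f θ‖ ≤ C) (n : ℤ) :
    |(n : ℝ)| ^ p * ‖fourierCoeffTwoPi f n‖ ≤ C := by
  induction p generalizing f with
  | zero => simpa using norm_fourierCoeffTwoPi_le hC n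
  | succ p ih =>
    rw [iteratedDeriv_succ'] at hC
    have := ih (contDiff_infty_iff_deriv.1 hf).2 (periodic_deriv hper) hC
    rw [fourierCoeffTwoPi_deriv hf hper, norm_mul, norm_mul, Complex.norm_I, one_mul,
      Complex.norm_intCast] at this
    rwa [pow_succ, mul_assoc]

theorem periodic_iteratedDeriv {f : ℝ → E} {T : ℝ} (hf : Function.Periodic f T) (p : ℕ) :
    Function.Periodic (iteratedDeriv p f) T := by
  induction p generalizing f with
  | zero => simpa using hf
  | succ p ih =>
    rw [iteratedDeriv_succ']
    exact ih (periodic_deriv hf)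

theorem rapidlyDecreasing_fourierCoeffTwoPi {f : ℝ → ℂ} (hf : ContDiff ℝ ∞ f)
    (hper : Function.Periodic f (2 * Real.pi)) :
    RapidlyDecreasing (fun n : ℤ => 1 + n.natAbs) (fourierCoeffTwoPi f) := fun p => by
  have exists_bound (q : ℕ) : ∃ C, ∀ θ, ‖iteratedDeriv q f θ‖ ≤ C := by
    obtain ⟨C, hC⟩ := isBounded_iff_forall_norm_le.1
      ((periodic_iteratedDeriv hper q).isBounded_of_continuous Real.two_pi_pos.ne'
        (hf.continuous_iteratedDeriv q (by exact_mod_cast le_top)))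
    exact ⟨C, fun θ => hC _ (mem_range_self θ)⟩
  obtain ⟨C, hC⟩ := exists_bound 0
  obtain ⟨D, hD⟩ := exists_bound p
  refine ⟨2 ^ (p - 1) * (C + D), fun n => one_add_natAbs_pow_mul_le (norm_nonneg _) ?_
    (abs_pow_mul_norm_fourierCoeffTwoPi_le hf hper hD n)⟩
  simpa using abs_pow_mul_norm_fourierCoeffTwoPi_le hf hper hC n

theorem hasSum_chr_smul_fourierCoeffTwoPi {f : ℝ → ℂ} (hf : ContDiff ℝ ∞ f)
    (hper : Function.Periodic f (2 * Real.pi)) (θ : ℝ) :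
    HasSum (fun n => chr n θ • fourierCoeffTwoPi f n) (f θ) := by
  have := Fact.mk Real.two_pi_pos
  let g : C(AddCircle (2 * Real.pi), ℂ) :=
    ⟨hper.lift, continuous_coinduced_dom.2 hf.continuous⟩
  have coeff_eq : fourierCoeff g = fourierCoeffTwoPi f :=
    funext fun n => (fourierCoeffTwoPi_coe g n).symm
  have hasSum_fourier := has_pointwise_sum_fourier_series_of_summable (f := g)
    (coeff_eq ▸ .of_norm ((rapidlyDecreasing_fourierCoeffTwoPi hf hper).summable_norm
      isTempered_int)) θ
  simp only [coeff_eq, smul_eq_mul, mul_comm (fourierCoeffTwoPi f _)] at hasSum_fourier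
  exact hasSum_fourier

end Fourier

/-! ### Approximate eigenvalues -/

section ApproxEigenpairs

variable {ι E : Type*} [NormedAddCommGroup E] [NormedSpace ℂ E] {l : Filter ι} {u : ι → E}

/-- The pairs of an operator and a scalar that `u` exhibits, along `l`, as an approximate
eigenvalue of the operator. -/
def approxEigenpairs (l : Filter ι) (u : ι → E) : Subalgebra ℂ ((E →L[ℂ] E) × ℂ) where
  carrier := {q | (fun N => q.1 (u N) - q.2 • u N) =o[l] u}
  mul_mem' {q q'} hq hq' := by
    have hmul : (fun N => q.1 (q'.1 (u N) - q'.2 • u N) + q'.2 • (q.1 (u N) - q.2 • u N)) =o[l] u :=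
      ((q.1.isBigO_comp _ l).trans_isLittleO hq').add (hq.const_smul_left q'.2)
    refine hmul.congr_left fun N => ?_
    simp only [Prod.fst_mul, Prod.snd_mul, mul_apply_eq_comp, map_sub, map_smul, smul_sub,
      smul_smul, mul_comm q.2]
    abel
  add_mem' {q q'} hq hq' := by
    refine (hq.add hq').congr_left fun N => ?_
    simp only [Prod.fst_add, Prod.snd_add, add_apply, add_smul]
    abel
  algebraMap_mem' a := by
    simp [Algebra.algebraMap_eq_smul_one]

theorem mem_approxEigenpairs {T : E →L[ℂ] E} {z : ℂ} :
    (T, z) ∈ approxEigenpairs l u ↔ (fun N => T (u N) - z • u N) =o[l] u := Iff.rfl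

theorem isClosed_approxEigenpairs :
    IsClosed (approxEigenpairs l u : Set ((E →L[ℂ] E) × ℂ)) := by
  refine isClosed_of_closure_subset fun q hq => isLittleO_iff.2 fun ε hε => ?_
  obtain ⟨q', hq', hdist⟩ := Metric.mem_closure_iff.1 hq (ε / 3) (by positivity)
  have hfst : ‖q.1 - q'.1‖ ≤ ε / 3 := (norm_fst_le (q - q')).trans (dist_eq_norm q q' ▸ hdist.le)
  have hsnd : ‖q.2 - q'.2‖ ≤ ε / 3 := (norm_snd_le (q - q')).trans (dist_eq_norm q q' ▸ hdist.le)
  filter_upwards [isLittleO_iff.1 hq' (show 0 < ε / 3 by positivity)] with N hN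
  calc ‖q.1 (u N) - q.2 • u N‖
      = ‖(q.1 - q'.1) (u N) - (q.2 - q'.2) • u N + (q'.1 (u N) - q'.2 • u N)‖ := by
        congr 1
        simp only [sub_apply, sub_smul]
        abel
    _ ≤ ‖q.1 - q'.1‖ * ‖u N‖ + ‖q.2 - q'.2‖ * ‖u N‖ + ε / 3 * ‖u N‖ :=
        norm_add_le_of_le (norm_sub_le_of_le (ContinuousLinearMap.le_opNorm _ _)
          (norm_smul_le _ _)) hN
    _ ≤ ε / 3 * ‖u N‖ + ε / 3 * ‖u N‖ + ε / 3 * ‖u N‖ := by gcongr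
    _ = ε * ‖u N‖ := by ring

theorem eq_of_mem_approxEigenpairs (hu : ∃ᶠ N in l, u N ≠ 0) {T : E →L[ℂ] E} {z z' : ℂ}
    (h : (T, z) ∈ approxEigenpairs l u) (h' : (T, z') ∈ approxEigenpairs l u) : z = z' := by
  by_contra hne
  have hsub : (fun N => (z' - z) • u N) =o[l] u :=
    (IsLittleO.sub h h').congr_left fun N => by simp [sub_smul]
  exact isLittleO_irrefl hu ((isLittleO_const_smul_left (sub_ne_zero.2 (Ne.symm hne))).1 hsub)

theorem ne_zero_of_mem_approxEigenpairs (hu : ∃ᶠ N in l, u N ≠ 0) {S T : E →L[ℂ] E} {z : ℂ}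
    (h : (T, z) ∈ approxEigenpairs l u) (hST : S * T = 1) : z ≠ 0 := by
  rintro rfl
  have hT : (fun N => T (u N)) =o[l] u := (mem_approxEigenpairs.1 h).congr_left fun N => by simp
  refine isLittleO_irrefl hu (((S.isBigO_comp _ l).trans_isLittleO hT).congr_left fun N => ?_)
  rw [← mul_apply_eq_comp, hST, one_apply_eq_self]

end ApproxEigenpairs

namespace SUq0

/-! ### Adapted coordinates on the basis -/

/-- The label with coordinates `k = min(a, b)`, `d = a - b`, `m = N - max(a, b)`. -/
def idx (k : ℕ) (d : ℤ) (m : ℕ) : Idx :=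
  ⟨k + d.natAbs + m, k + d.toNat, k + (-d).toNat, by omega, by omega⟩

theorem idx_inj {k k' m m' : ℕ} {d d' : ℤ} :
    idx k d m = idx k' d' m' ↔ k = k' ∧ d = d' ∧ m = m' := by
  simp only [idx, Idx.mk.injEq]
  omega

theorem exists_idx (p : Idx) : ∃ k d m, p = idx k d m := by
  obtain ⟨N, a, b, ha, hb⟩ := p
  refine ⟨min a b, (a : ℤ) - b, N - max a b, ?_⟩
  simp only [idx, Idx.mk.injEq]
  omega

theorem shiftUp_idx (k : ℕ) (d : ℤ) (m : ℕ) : shiftUp (idx k d m) = idx (k + 1) d m := by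
  simp only [idx, shiftUp, Idx.mk.injEq]
  omega

/-- The basis vectors in the adapted coordinates, with signs that turn `β` into a shift. -/
def vec (k : ℕ) (d : ℤ) (m : ℕ) : H := (-1 : ℂ) ^ d.toNat • e (idx k d m)

theorem e_idx (k : ℕ) (d : ℤ) (m : ℕ) : e (idx k d m) = (-1 : ℂ) ^ d.toNat • vec k d m := by
  rw [vec, smul_smul, ← mul_pow]
  simp

theorem inner_e_left (p : Idx) (ξ : H) : ⟪e p, ξ⟫_ℂ = ξ p := by
  classical
  have := lp.inner_single_left (𝕜 := ℂ) p (1 : ℂ) ξ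
  simpa [e] using this

theorem norm_e (p : Idx) : ‖e p‖ = 1 := by
  classical
  rw [e, lp.norm_single (by simp), norm_one]

theorem norm_vec (k : ℕ) (d : ℤ) (m : ℕ) : ‖vec k d m‖ = 1 := by
  simp [vec, norm_smul, norm_e]

theorem inner_vec_vec (k k' m m' : ℕ) (d d' : ℤ) :
    ⟪vec k d m, vec k' d' m'⟫_ℂ = if k = k' ∧ d = d' ∧ m = m' then 1 else 0 := by
  rw [vec, vec, inner_smul_left, inner_smul_right, inner_e_left]
  split_ifs with h
  · obtain ⟨rfl, rfl, rfl⟩ := h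
    rw [e_apply_self]
    simp [← mul_pow]
  · rw [e_apply_ne (by rwa [Ne, idx_inj]), mul_zero, mul_zero]

theorem hasSum_e (ξ : H) : HasSum (fun p => ξ p • e p) ξ := by
  classical
  convert lp.hasSum_single (p := 2) (by simp) ξ using 2 with p
  rw [e, ← lp.single_smul]
  simp

theorem ext_e {x y : H →L[ℂ] H} (h : ∀ p, x (e p) = y (e p)) : x = y := by
  ext1 ξ
  have hx := (hasSum_e ξ).mapL x
  have hy := (hasSum_e ξ).mapL y
  simp only [map_smul, h] at hx hy
  exact hx.unique hy

theorem ext_vec {x y : H →L[ℂ] H} (h : ∀ k d m, x (vec k d m) = y (vec k d m)) : x = y := by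
  refine ext_e fun p => ?_
  obtain ⟨k, d, m, rfl⟩ := exists_idx p
  simp only [e_idx, map_smul, h]

theorem vec_eq_zero_of_inner {ξ : H} (h : ∀ k d m, ⟪vec k d m, ξ⟫_ℂ = 0) : ξ = 0 := by
  ext p
  obtain ⟨k, d, m, rfl⟩ := exists_idx p
  rw [← inner_e_left, e_idx, inner_smul_left, h]
  simp

/-! ### The generators in the adapted coordinates -/

theorem star_coordOp_e (c : Idx → ℂ) (φ : Idx → Idx) (hc : ∀ p, ‖c p‖ ≤ 1)
    (hφ : InjOn φ {p | c p ≠ 0}) (p : Idx) :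
    star (coordOp c φ hc hφ) (e p) = (starRingEnd ℂ) (c p) • e (φ p) := by
  ext q
  rw [← inner_e_left, ContinuousLinearMap.star_eq_adjoint,
    ContinuousLinearMap.adjoint_inner_right, ← inner_conj_symm, inner_e_left, coordOp_apply,
    lp.coeFn_smul, Pi.smul_apply, smul_eq_mul, map_mul]
  congr 1
  by_cases h : φ p = q
  · subst h
    simp [e_apply_self]
  · rw [e_apply_ne h, e_apply_ne (Ne.symm h), map_zero]

theorem α_vec_succ (k : ℕ) (d : ℤ) (m : ℕ) : α (vec (k + 1) d m) = vec k d m := by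
  rw [vec, map_smul, ← shiftUp_idx, α_e_shiftUp, vec]

theorem α_vec_zero (d : ℤ) (m : ℕ) : α (vec 0 d m) = 0 := by
  rw [vec, map_smul, α_e_boundary, smul_zero]
  simp only [idx]
  omega

theorem star_α_vec (k : ℕ) (d : ℤ) (m : ℕ) : star α (vec k d m) = vec (k + 1) d m := by
  rw [vec, map_smul, α, star_coordOp_e, shiftUp_idx, vec]
  simp

theorem star_β_vec_succ (k : ℕ) (d : ℤ) (m : ℕ) : star β (vec (k + 1) d m) = 0 := by
  rw [vec, map_smul, β, star_coordOp_e]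
  simp [βcoeff, idx]

theorem star_β_vec_zero (d : ℤ) (m : ℕ) : star β (vec 0 d m) = vec 0 (d - 1) m := by
  have hi : βindex (idx 0 d m) = idx 0 (d - 1) m := by
    simp only [βindex, idx, zero_add]
    split_ifs with h <;> simp only [Idx.mk.injEq] <;> omega
  rw [vec, map_smul, β, star_coordOp_e, hi, vec, smul_smul]
  congr 1
  simp only [βcoeff, idx, zero_add]
  split_ifs with h h'
  · have : (d - 1).toNat = d.toNat := by omega
    simp [this]
  · obtain ⟨j, hj⟩ : ∃ j, j = (d - 1).toNat := ⟨_, rfl⟩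
    have : d.toNat = j + 1 := by omega
    rw [this, ← hj, pow_succ]
    simp
  · omega

theorem β_vec_succ (k : ℕ) (d : ℤ) (m : ℕ) : β (vec (k + 1) d m) = 0 := by
  rw [vec, map_smul, β_e_interior, smul_zero] <;> simp [idx]

theorem β_vec_zero (d : ℤ) (m : ℕ) : β (vec 0 d m) = vec 0 (d + 1) m := by
  refine sub_eq_zero.1 (vec_eq_zero_of_inner fun k' d' m' => ?_)
  rw [inner_sub_right, ← ContinuousLinearMap.adjoint_inner_left,
    ← ContinuousLinearMap.star_eq_adjoint]
  rcases k' with _ | k'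
  · rw [star_β_vec_zero, inner_vec_vec, inner_vec_vec, sub_eq_zero]
    congr 1
    simp only [true_and, eq_iff_iff]
    omega
  · rw [star_β_vec_succ, inner_vec_vec]
    simp

theorem α_pow_vec (j k : ℕ) (d : ℤ) (m : ℕ) :
    (α ^ j) (vec k d m) = if j ≤ k then vec (k - j) d m else 0 := by
  induction j generalizing k with
  | zero => simp
  | succ j ih =>
    rw [pow_succ, mul_apply_eq_comp]
    rcases k with _ | k
    · rw [α_vec_zero, map_zero, if_neg (by omega)]
    · rw [α_vec_succ, ih]
      simp

theorem star_α_pow_vec (j k : ℕ) (d : ℤ) (m : ℕ) :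
    ((star α) ^ j) (vec k d m) = vec (k + j) d m := by
  induction j generalizing k with
  | zero => simp
  | succ j ih =>
    rw [pow_succ, mul_apply_eq_comp, star_α_vec, ih]
    congr 1
    omega

theorem β_pow_vec_zero (j : ℕ) (d : ℤ) (m : ℕ) : (β ^ j) (vec 0 d m) = vec 0 (d + j) m := by
  induction j generalizing d with
  | zero => simp
  | succ j ih =>
    rw [pow_succ, mul_apply_eq_comp, β_vec_zero, ih]
    congr 1
    push_cast
    ring

theorem star_β_pow_vec_zero (j : ℕ) (d : ℤ) (m : ℕ) :
    ((star β) ^ j) (vec 0 d m) = vec 0 (d - j) m := by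
  induction j generalizing d with
  | zero => simp
  | succ j ih =>
    rw [pow_succ, mul_apply_eq_comp, star_β_vec_zero, ih]
    congr 1
    push_cast
    ring

theorem βpow_vec (n : ℤ) (k : ℕ) (d : ℤ) (m : ℕ) :
    βpow n (vec k d m) = if k = 0 then vec 0 (d + n) m else 0 := by
  unfold βpow
  rcases k with _ | k
  · rw [if_pos rfl]
    split_ifs with h1 h2
    · rw [β_pow_vec_zero, Int.toNat_of_nonneg h1.le]
    · rw [star_β_pow_vec_zero, Int.toNat_of_nonneg (by omega), sub_neg_eq_add]
    · rw [mul_apply_eq_comp, β_vec_zero, star_β_vec_zero]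
      congr 1
      omega
  · rw [if_neg (Nat.succ_ne_zero k)]
    split_ifs with h1 h2
    · obtain ⟨j, hj⟩ : ∃ j, n.toNat = j + 1 := ⟨n.toNat - 1, by omega⟩
      rw [hj, pow_succ, mul_apply_eq_comp, β_vec_succ, map_zero]
    · obtain ⟨j, hj⟩ : ∃ j, (-n).toNat = j + 1 := ⟨(-n).toNat - 1, by omega⟩
      rw [hj, pow_succ, mul_apply_eq_comp, star_β_vec_succ, map_zero]
    · rw [mul_apply_eq_comp, β_vec_succ, map_zero]

/-- `α*^k β^n α^l`, with the convention of `βpow` for `n ≤ 0`. -/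
def cell (κ : ℕ × ℕ × ℤ) : H →L[ℂ] H := (star α) ^ κ.1 * βpow κ.2.2 * α ^ κ.2.1

/-- `α^n` for `n ≥ 0` and `α*^(-n)` for `n < 0`. -/
def tau (n : ℤ) : H →L[ℂ] H := if 0 ≤ n then α ^ n.toNat else (star α) ^ (-n).toNat

theorem cell_vec (k l : ℕ) (n : ℤ) (j : ℕ) (d : ℤ) (m : ℕ) :
    cell (k, l, n) (vec j d m) = if j = l then vec k (d + n) m else 0 := by
  rw [cell, mul_apply_eq_comp, mul_apply_eq_comp, α_pow_vec]
  dsimp only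
  split_ifs with h1 h2 h2
  · subst h2
    rw [βpow_vec, if_pos (by omega), star_α_pow_vec, zero_add]
  · rw [βpow_vec, if_neg (by omega), map_zero]
  · omega
  · simp

theorem tau_vec (n : ℤ) (k : ℕ) (d : ℤ) (m : ℕ) :
    tau n (vec k d m) = if n ≤ k then vec (k - n).toNat d m else 0 := by
  unfold tau
  split_ifs with h1 h2 h2
  · rw [α_pow_vec, if_pos (by omega)]
    congr 1
    omega
  · rw [α_pow_vec, if_neg (by omega)]
  · rw [star_α_pow_vec]
    congr 1
    omega
  · omega

/-- The operators whose rapidly decreasing combinations make up the smooth algebra. -/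
def atom : ℤ ⊕ ℕ × ℕ × ℤ → H →L[ℂ] H := Sum.elim tau cell

theorem atom_inl (n : ℤ) : atom (.inl n) = tau n := rfl

theorem atom_inr (κ : ℕ × ℕ × ℤ) : atom (.inr κ) = cell κ := rfl

/-! ### The multiplication table -/

theorem cell_mul_cell (κ κ' : ℕ × ℕ × ℤ) : cell κ * cell κ' =
    if κ.2.1 = κ'.1 then cell (κ.1, κ'.2.1, κ.2.2 + κ'.2.2) else 0 := by
  obtain ⟨k, l, n⟩ := κ
  obtain ⟨k', l', n'⟩ := κ'
  refine ext_vec fun j d m => ?_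
  rw [mul_apply_eq_comp, cell_vec]
  by_cases h : l = k'
  · subst h
    by_cases hj : j = l'
    · simp [hj, cell_vec, add_assoc, add_comm n]
    · simp [hj, cell_vec]
  · by_cases hj : j = l'
    · simp [hj, cell_vec, h, Ne.symm h]
    · simp [hj, h]

theorem tau_mul_cell (j : ℤ) (κ : ℕ × ℕ × ℤ) : tau j * cell κ =
    if j ≤ κ.1 then cell ((κ.1 - j).toNat, κ.2.1, κ.2.2) else 0 := by
  obtain ⟨k, l, n⟩ := κ
  refine ext_vec fun i d m => ?_
  rw [mul_apply_eq_comp, cell_vec]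
  by_cases hj : i = l <;> by_cases h : j ≤ k <;> simp [hj, h, tau_vec, cell_vec]

theorem cell_mul_tau (j : ℤ) (κ : ℕ × ℕ × ℤ) : cell κ * tau j =
    if 0 ≤ κ.2.1 + j then cell (κ.1, (κ.2.1 + j).toNat, κ.2.2) else 0 := by
  obtain ⟨k, l, n⟩ := κ
  refine ext_vec fun i d m => ?_
  rw [mul_apply_eq_comp, tau_vec]
  by_cases h : j ≤ i
  · rw [if_pos h, cell_vec]
    by_cases h1 : (0 : ℤ) ≤ l + j
    · simp only [h1, if_true, cell_vec]
      refine if_congr (by omega) rfl rfl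
    · rw [if_neg (by omega)]
      simp [h1]
  · rw [if_neg h, map_zero]
    split_ifs with h1
    · rw [cell_vec, if_neg (by omega)]
    · simp

theorem tau_mul_tau (i j : ℤ) : tau i * tau j = tau (i + j) -
    ∑ k ∈ Finset.range j.toNat with i + j ≤ (k : ℕ), cell ((k - i - j).toNat, k, 0) := by
  refine ext_vec fun k d m => ?_
  rw [mul_apply_eq_comp, sub_apply, tau_vec, tau_vec, sum_apply]
  simp only [cell_vec, Finset.sum_ite_eq, Finset.mem_filter, Finset.mem_range, add_zero]
  by_cases h : j ≤ k
  · rw [if_pos h, tau_vec, if_neg (by omega : ¬ (k < j.toNat ∧ i + j ≤ k)), sub_zero]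
    refine if_ctx_congr (by omega) (fun _ => ?_) fun _ => rfl
    congr 1
    omega
  · rw [if_neg h, map_zero]
    by_cases h1 : i + j ≤ k
    · rw [if_pos h1, if_pos ⟨by omega, h1⟩, sub_sub, sub_self]
    · simp [h1]

theorem tau_zero : tau 0 = 1 := by simp [tau]

theorem tau_one : tau 1 = α := by simp [tau]

theorem tau_neg_one : tau (-1) = star α := by simp [tau]

theorem cell_one : cell (0, 0, 1) = β := by simp [cell, βpow]

theorem cell_neg_one : cell (0, 0, -1) = star β := by simp [cell, βpow]

/-! ### The C*-algebra is the closed span of the atoms -/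

/-- The monoid of words in `α`, `β` and their adjoints. -/
def words : Submonoid (H →L[ℂ] H) := Submonoid.closure ({α, β} ∪ star {α, β})

theorem α_mem_words : α ∈ words := Submonoid.subset_closure (by simp)

theorem β_mem_words : β ∈ words := Submonoid.subset_closure (by simp)

theorem star_α_mem_words : star α ∈ words := Submonoid.subset_closure (by simp)

theorem star_β_mem_words : star β ∈ words := Submonoid.subset_closure (by simp)

theorem βpow_mem_words (n : ℤ) : βpow n ∈ words := by
  unfold βpow
  split_ifs
  exacts [pow_mem β_mem_words _, pow_mem star_β_mem_words _,
    mul_mem star_β_mem_words β_mem_words]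

theorem atom_mem_words : ∀ i, atom i ∈ words
  | .inl n => by
    rw [atom_inl, tau]
    split_ifs
    exacts [pow_mem α_mem_words _, pow_mem star_α_mem_words _]
  | .inr _ => mul_mem (mul_mem (pow_mem star_α_mem_words _) (βpow_mem_words _))
    (pow_mem α_mem_words _)

theorem norm_coordOp_le (c : Idx → ℂ) (φ : Idx → Idx) (hc : ∀ p, ‖c p‖ ≤ 1)
    (hφ : InjOn φ {p | c p ≠ 0}) : ‖coordOp c φ hc hφ‖ ≤ 1 :=
  LinearMap.mkContinuous_norm_le _ zero_le_one _

theorem norm_le_one_of_mem_words {x : H →L[ℂ] H} (hx : x ∈ words) : ‖x‖ ≤ 1 := by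
  have norm_α_le : ‖α‖ ≤ 1 := norm_coordOp_le _ _ _ _
  have norm_β_le : ‖β‖ ≤ 1 := norm_coordOp_le _ _ _ _
  induction hx using Submonoid.closure_induction with
  | mem x hx =>
    rw [mem_union, mem_star] at hx
    rcases hx with (rfl | rfl) | (hx | hx)
    exacts [norm_α_le, norm_β_le, (norm_star x).symm.trans_le (hx ▸ norm_α_le),
      (norm_star x).symm.trans_le (Set.mem_singleton_iff.1 hx ▸ norm_β_le)]
  | one => exact ContinuousLinearMap.norm_id_le
  | mul x y _ _ hx hy => exact (norm_mul_le _ _).trans (mul_le_one₀ hx (norm_nonneg _) hy)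

theorem norm_atom_le (i : ℤ ⊕ ℕ × ℕ × ℤ) : ‖atom i‖ ≤ 1 :=
  norm_le_one_of_mem_words (atom_mem_words i)

theorem summable_norm_smul_atom {ι : Type*} {d : ι → ℂ} (hd : Summable fun j => ‖d j‖)
    (i : ι → ℤ ⊕ ℕ × ℕ × ℤ) : Summable fun j => ‖d j • atom (i j)‖ :=
  hd.of_nonneg_of_le (fun _ => norm_nonneg _) fun j =>
    (norm_smul_le _ _).trans (mul_le_of_le_one_right (norm_nonneg _) (norm_atom_le (i j)))

theorem mem_cstarA_of_mem_words {x : H →L[ℂ] H} (hx : x ∈ words) : x ∈ cstarA :=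
  StarSubalgebra.le_topologicalClosure _ <|
    (Submonoid.closure_le (S := (StarAlgebra.adjoin ℂ {α, β}).toSubmonoid)).2
      Algebra.subset_adjoin hx

theorem atom_mem_cstarA (i : ℤ ⊕ ℕ × ℕ × ℤ) : atom i ∈ cstarA :=
  mem_cstarA_of_mem_words (atom_mem_words i)

theorem isClosed_cstarA : IsClosed (cstarA : Set (H →L[ℂ] H)) :=
  StarSubalgebra.isClosed_topologicalClosure _

theorem cell_mem_span (κ : ℕ × ℕ × ℤ) : cell κ ∈ Submodule.span ℂ (range atom) :=
  Submodule.subset_span ⟨.inr κ, rfl⟩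

theorem tau_mem_span (n : ℤ) : tau n ∈ Submodule.span ℂ (range atom) :=
  Submodule.subset_span ⟨.inl n, rfl⟩

theorem atom_mul_atom_mem_span (i j : ℤ ⊕ ℕ × ℕ × ℤ) :
    atom i * atom j ∈ Submodule.span ℂ (range atom) := by
  rcases i with i | κ <;> rcases j with j | κ' <;> simp only [atom_inl, atom_inr]
  · rw [tau_mul_tau]
    exact sub_mem (tau_mem_span _) (sum_mem fun _ _ => cell_mem_span _)
  · rw [tau_mul_cell]
    split_ifs
    exacts [cell_mem_span _, zero_mem _]
  · rw [cell_mul_tau]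
    split_ifs
    exacts [cell_mem_span _, zero_mem _]
  · rw [cell_mul_cell]
    split_ifs
    exacts [cell_mem_span _, zero_mem _]

theorem mem_span_of_mem_words {x : H →L[ℂ] H} (hx : x ∈ words) :
    x ∈ Submodule.span ℂ (range atom) := by
  induction hx using Submonoid.closure_induction with
  | mem x hx =>
    rw [mem_union, mem_star] at hx
    rcases hx with (rfl | rfl) | (hx | hx)
    · exact tau_one ▸ tau_mem_span 1
    · exact cell_one ▸ cell_mem_span (0, 0, 1)
    · rw [← star_star x, hx]
      exact tau_neg_one ▸ tau_mem_span (-1)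
    · rw [← star_star x, Set.mem_singleton_iff.1 hx]
      exact cell_neg_one ▸ cell_mem_span (0, 0, -1)
  | one => exact tau_zero ▸ tau_mem_span 0
  | mul x y _ _ hx hy =>
    have span_mul_le : Submodule.span ℂ (range atom) * Submodule.span ℂ (range atom) ≤
        Submodule.span ℂ (range atom) := by
      rw [Submodule.span_mul_span, Submodule.span_le]
      rintro _ ⟨_, ⟨i, rfl⟩, _, ⟨j, rfl⟩, rfl⟩
      exact atom_mul_atom_mem_span i j
    exact span_mul_le (Submodule.mul_mem_mul hx hy)

theorem cstarA_subset_closure_span :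
    (cstarA : Set (H →L[ℂ] H)) ⊆ closure (Submodule.span ℂ (range atom)) := by
  refine closure_mono fun x hx => ?_
  have hx' : x ∈ Subalgebra.toSubmodule (Algebra.adjoin ℂ ({α, β} ∪ star {α, β})) := hx
  rw [Algebra.adjoin_eq_span] at hx'
  exact Submodule.span_le.2 (fun _ => mem_span_of_mem_words) hx'

theorem eq_of_atom {F : Type*} [NormedAddCommGroup F] [NormedSpace ℂ F]
    {φ ψ : (H →L[ℂ] H) →L[ℂ] F} (h : ∀ i, φ (atom i) = ψ (atom i)) {x : H →L[ℂ] H}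
    (hx : x ∈ cstarA) : φ x = ψ x :=
  ContinuousLinearMap.eqOn_closure_span (forall_mem_range.2 h) (cstarA_subset_closure_span hx)

/-! ### Matrix coefficients -/

/-- The matrix coefficient `x ↦ ⟪ξ, x η⟫` of operators. -/
def matrixCoeff (ξ η : H) : (H →L[ℂ] H) →L[ℂ] ℂ :=
  (innerSL ℂ ξ).comp (ContinuousLinearMap.apply ℂ H η)

theorem matrixCoeff_apply (ξ η : H) (x : H →L[ℂ] H) : matrixCoeff ξ η x = ⟪ξ, x η⟫_ℂ := by
  simp [matrixCoeff]

/-- The coefficient of `cell κ`, for series in which no `tau` occurs. -/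
def coef (κ : ℕ × ℕ × ℤ) : (H →L[ℂ] H) →L[ℂ] ℂ :=
  matrixCoeff (vec κ.1 κ.2.2 0) (vec κ.2.1 0 0)

theorem coef_apply (κ : ℕ × ℕ × ℤ) (x : H →L[ℂ] H) :
    coef κ x = ⟪vec κ.1 κ.2.2 0, x (vec κ.2.1 0 0)⟫_ℂ := matrixCoeff_apply _ _ x

theorem norm_coef_le (κ : ℕ × ℕ × ℤ) (x : H →L[ℂ] H) : ‖coef κ x‖ ≤ ‖x‖ := by
  rw [coef_apply]
  refine (norm_inner_le_norm _ _).trans ?_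
  rw [norm_vec, one_mul]
  exact (x.le_opNorm _).trans_eq (by rw [norm_vec, mul_one])

theorem coef_cell (κ κ' : ℕ × ℕ × ℤ) : coef κ (cell κ') = if κ = κ' then 1 else 0 := by
  obtain ⟨k, l, n⟩ := κ
  obtain ⟨k', l', n'⟩ := κ'
  rw [coef_apply, cell_vec]
  by_cases h : l = l'
  · simp [h, inner_vec_vec]
  · simp [h]

theorem matrixCoeff_vec {x : H →L[ℂ] H} (hx : x ∈ cstarA) (k k' m m' : ℕ) (d d' : ℤ) :
    matrixCoeff (vec k d m) (vec k' d' m') x = if m = m' then coef (k, k', d - d') x else 0 := by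
  have matrixCoeff_atom (i : ℤ ⊕ ℕ × ℕ × ℤ) : matrixCoeff (vec k d m) (vec k' d' m') (atom i) =
      ((if m = m' then 1 else 0 : ℂ) • coef (k, k', d - d')) (atom i) := by
    rw [smul_apply, coef_apply, matrixCoeff_apply]
    rcases i with n | ⟨l, l', n⟩
    · rw [atom_inl, tau_vec, tau_vec]
      split_ifs <;> simp [inner_vec_vec, sub_eq_zero, *]
    · rw [atom_inr, cell_vec, cell_vec]
      split_ifs <;> simp [inner_vec_vec, sub_eq_iff_eq_add', *]
  rw [eq_of_atom matrixCoeff_atom hx, smul_apply, ite_smul, one_smul, zero_smul]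

theorem coef_tau (κ : ℕ × ℕ × ℤ) (j : ℤ) :
    coef κ (tau j) = if κ.2.2 = 0 ∧ j = κ.2.1 - κ.1 then 1 else 0 := by
  obtain ⟨k, l, n⟩ := κ
  rw [coef_apply, tau_vec]
  dsimp only
  split_ifs with h1 h2 h2
  · rw [inner_vec_vec, if_pos]
    omega
  · rw [inner_vec_vec, if_neg]
    omega
  · omega
  · simp

theorem eq_of_coef {x y : H →L[ℂ] H} (hx : x ∈ cstarA) (hy : y ∈ cstarA)
    (h : ∀ κ, coef κ x = coef κ y) : x = y := by
  refine ext_vec fun k' d' m' => sub_eq_zero.1 (vec_eq_zero_of_inner fun k d m => ?_)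
  rw [inner_sub_right, ← matrixCoeff_apply, ← matrixCoeff_apply, matrixCoeff_vec hx,
    matrixCoeff_vec hy, h, sub_self]

theorem coef_cell_mul_mul_cell {x : H →L[ℂ] H} (hx : x ∈ cstarA) (κ κ' κ₁ : ℕ × ℕ × ℤ) :
    coef κ₁ (cell κ * x * cell κ') = if κ₁.1 = κ.1 ∧ κ₁.2.1 = κ'.2.1 then
      coef (κ.2.1, κ'.1, κ₁.2.2 - κ.2.2 - κ'.2.2) x else 0 := by
  obtain ⟨k, l, n⟩ := κ
  obtain ⟨k', l', n'⟩ := κ'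
  obtain ⟨k₁, l₁, n₁⟩ := κ₁
  have coef_atom (i : ℤ ⊕ ℕ × ℕ × ℤ) :
      ((coef (k₁, l₁, n₁)).comp
        (ContinuousLinearMap.mulLeftRight ℂ _ (cell (k, l, n)) (cell (k', l', n')))) (atom i) =
      ((if k₁ = k ∧ l₁ = l' then 1 else 0 : ℂ) • coef (l, k', n₁ - n - n')) (atom i) := by
    rw [ContinuousLinearMap.comp_apply, ContinuousLinearMap.mulLeftRight_apply, smul_apply]
    rcases i with j | ⟨a, b, j⟩
    · simp only [atom_inl, cell_mul_tau, ite_mul, zero_mul, cell_mul_cell, apply_ite (coef _),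
        map_zero, coef_cell, coef_tau, Prod.mk.injEq, smul_eq_mul, one_mul]
      split_ifs <;> first | rfl | omega
    · simp only [atom_inr, ite_mul, zero_mul, cell_mul_cell, apply_ite (coef _), map_zero,
        coef_cell, Prod.mk.injEq, smul_eq_mul, one_mul]
      split_ifs <;> first | rfl | omega
  rw [← ContinuousLinearMap.mulLeftRight_apply ℂ, ← ContinuousLinearMap.comp_apply,
    eq_of_atom coef_atom hx, smul_apply, ite_smul, one_smul, zero_smul]

/-! ### Gauges on the span of the atoms -/

/-- The size of the label of an atom, whose powers measure rapid decay. -/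
def size : ℤ ⊕ ℕ × ℕ × ℤ → ℕ :=
  Sum.elim (fun n => 1 + n.natAbs) fun κ => 1 + κ.1 + κ.2.1 + κ.2.2.natAbs

theorem isTempered_size_inr : IsTempered fun κ : ℕ × ℕ × ℤ => size (.inr κ) :=
  isTempered_nat.prod (t := fun q : ℕ × ℤ => 1 + q.1 + q.2.natAbs)
    (isTempered_nat.prod isTempered_int (fun q => by omega) fun q => by omega)
    (fun q => by simp only [size, Sum.elim_inr]; omega)
    fun q => by simp only [size, Sum.elim_inr]; omega

theorem isTempered_size : IsTempered size := isTempered_int.sumElim isTempered_size_inr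

/-- The weights for which the cost of an expansion into atoms is submultiplicative: since
`tau i * tau j` involves up to `|j|` atoms `cell κ`, the weights of the `tau`s carry one more power,
and the factor `2` there absorbs the sum of the two kinds of terms. -/
def weight (p : ℕ) : ℤ ⊕ ℕ × ℕ × ℤ → ℕ :=
  Sum.elim (fun n => 2 * (1 + n.natAbs) ^ (p + 1)) fun κ => size (.inr κ) ^ p

theorem one_add_add_le_mul (m n : ℕ) : 1 + m + n ≤ (1 + m) * (1 + n) := by
  nlinarith [Nat.zero_le (m * n)]

theorem size_inr_le_mul {κ κ' κ₁ : ℕ × ℕ × ℤ} (h : κ₁.1 + κ₁.2.1 + κ₁.2.2.natAbs ≤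
    κ.1 + κ.2.1 + κ.2.2.natAbs + (κ'.1 + κ'.2.1 + κ'.2.2.natAbs)) :
    size (.inr κ₁) ≤ size (.inr κ) * size (.inr κ') := by
  refine le_trans ?_ ((one_add_add_le_mul (κ.1 + κ.2.1 + κ.2.2.natAbs)
    (κ'.1 + κ'.2.1 + κ'.2.2.natAbs)).trans_eq ?_) <;> simp only [size, Sum.elim_inr]
  · omega
  · ring

theorem size_pow_le_weight (p : ℕ) (i : ℤ ⊕ ℕ × ℕ × ℤ) : size i ^ p ≤ weight p i := by
  rcases i with n | κ
  · calc (1 + n.natAbs) ^ p ≤ (1 + n.natAbs) ^ (p + 1) :=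
        Nat.pow_le_pow_right (by omega) p.le_succ
      _ ≤ 2 * (1 + n.natAbs) ^ (p + 1) := Nat.le_mul_of_pos_left _ two_pos
  · exact le_rfl

theorem weight_le_size_pow (p : ℕ) (i : ℤ ⊕ ℕ × ℕ × ℤ) : weight p i ≤ 2 * size i ^ (p + 1) := by
  rcases i with n | κ
  · exact le_rfl
  · calc size (.inr κ) ^ p ≤ size (.inr κ) ^ (p + 1) :=
        Nat.pow_le_pow_right (isTempered_size.one_le _) p.le_succ
      _ ≤ 2 * size (.inr κ) ^ (p + 1) := Nat.le_mul_of_pos_left _ two_pos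

theorem one_le_weight (p : ℕ) (i : ℤ ⊕ ℕ × ℕ × ℤ) : 1 ≤ weight p i :=
  (Nat.one_le_pow _ _ (isTempered_size.one_le i)).trans (size_pow_le_weight p i)

/-- The least cost of an expansion into atoms for the weights `weight p`. -/
abbrev cost (p : ℕ) : (H →L[ℂ] H) → ℝ≥0∞ := atomicNorm atom fun i => weight p i

theorem enorm_atom_le (i : ℤ ⊕ ℕ × ℕ × ℤ) : ‖atom i‖ₑ ≤ 1 := by
  rw [← ofReal_norm, ENNReal.ofReal_le_one]
  exact norm_atom_le i

theorem one_le_coe_weight (p : ℕ) (i : ℤ ⊕ ℕ × ℕ × ℤ) : (1 : ℝ≥0∞) ≤ weight p i :=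
  mod_cast one_le_weight p i

theorem cost_tau_le (p : ℕ) (n : ℤ) : cost p (tau n) ≤ (2 * (1 + n.natAbs) ^ (p + 1) : ℕ) :=
  atomicNorm_atom_le (Sum.inl n)

theorem cost_cell_le (p : ℕ) (κ : ℕ × ℕ × ℤ) : cost p (cell κ) ≤ (size (.inr κ) ^ p : ℕ) :=
  atomicNorm_atom_le (Sum.inr κ)

theorem cost_cell_mul_cell_le (p : ℕ) (κ κ' : ℕ × ℕ × ℤ) :
    cost p (cell κ * cell κ') ≤ (weight p (.inr κ) * weight p (.inr κ') : ℕ) := by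
  rw [cell_mul_cell]
  split_ifs
  · refine (cost_cell_le p _).trans (Nat.cast_le.2 ?_)
    exact (Nat.pow_le_pow_left (size_inr_le_mul (by dsimp only; omega)) p).trans_eq
      (mul_pow _ _ _)
  · simp [atomicNorm_zero]

theorem cost_tau_mul_cell_le (p : ℕ) (j : ℤ) (κ : ℕ × ℕ × ℤ) :
    cost p (tau j * cell κ) ≤ (weight p (.inl j) * weight p (.inr κ) : ℕ) := by
  rw [tau_mul_cell]
  split_ifs
  · refine (cost_cell_le p _).trans (Nat.cast_le.2 ?_)
    refine (Nat.pow_le_pow_left (size_inr_le_mul (κ := (j.natAbs, 0, 0)) (κ' := κ) ?_) p).trans ?_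
    · dsimp only
      omega
    · rw [mul_pow]
      exact Nat.mul_le_mul_right _ (size_pow_le_weight p (.inl j))
  · simp [atomicNorm_zero]

theorem cost_cell_mul_tau_le (p : ℕ) (κ : ℕ × ℕ × ℤ) (j : ℤ) :
    cost p (cell κ * tau j) ≤ (weight p (.inr κ) * weight p (.inl j) : ℕ) := by
  rw [cell_mul_tau]
  split_ifs
  · refine (cost_cell_le p _).trans (Nat.cast_le.2 ?_)
    refine (Nat.pow_le_pow_left (size_inr_le_mul (κ := κ) (κ' := (j.natAbs, 0, 0)) ?_) p).trans ?_
    · dsimp only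
      omega
    · rw [mul_pow]
      exact Nat.mul_le_mul_left _ (size_pow_le_weight p (.inl j))
  · simp [atomicNorm_zero]

theorem cost_tau_mul_tau_le (p : ℕ) (i j : ℤ) :
    cost p (tau i * tau j) ≤ (weight p (.inl i) * weight p (.inl j) : ℕ) := by
  set P := (1 + i.natAbs) * (1 + j.natAbs) with hP
  have cost_cell_le_pow : ∀ k ∈ Finset.range j.toNat, i + j ≤ (k : ℕ) →
      cost p (cell ((k - i - j).toNat, k, 0)) ≤ (P ^ p : ℕ) := fun k hk hk' => by
    refine (cost_cell_le p _).trans (Nat.cast_le.2 (Nat.pow_le_pow_left ?_ p))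
    have : size (.inr ((k - i - j).toNat, k, 0)) ≤ 1 + i.natAbs + j.natAbs := by
      have := Finset.mem_range.1 hk
      simp only [size, Sum.elim_inr]
      omega
    exact this.trans (one_add_add_le_mul _ _)
  have cost_sum_le : cost p (∑ k ∈ Finset.range j.toNat with i + j ≤ (k : ℕ),
      cell ((k - i - j).toNat, k, 0)) ≤ (j.natAbs * P ^ p : ℕ) := by
    refine (atomicNorm_sum_le enorm_atom_le (one_le_coe_weight p) _ _).trans ?_
    rw [Finset.sum_filter]
    refine (Finset.sum_le_card_nsmul _ _ ((P ^ p : ℕ) : ℝ≥0∞) fun k hk => ?_).trans ?_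
    · split_ifs with hk'
      exacts [cost_cell_le_pow k hk hk', zero_le]
    · rw [Finset.card_range, nsmul_eq_mul, ← Nat.cast_mul, Nat.cast_le]
      exact Nat.mul_le_mul_right _ (by omega)
  rw [tau_mul_tau]
  refine (atomicNorm_sub_le enorm_atom_le (one_le_coe_weight p) _ _).trans
    ((add_le_add (cost_tau_le p (i + j)) cost_sum_le).trans ?_)
  rw [← Nat.cast_add, Nat.cast_le]
  calc 2 * (1 + (i + j).natAbs) ^ (p + 1) + j.natAbs * P ^ p
      ≤ 2 * P ^ (p + 1) + P * P ^ p := by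
        gcongr
        · have := Int.natAbs_add_le i j
          exact le_trans (by omega) (one_add_add_le_mul _ _)
        · exact le_trans (by omega) (one_add_add_le_mul _ _)
    _ ≤ 2 * (1 + i.natAbs) ^ (p + 1) * (2 * (1 + j.natAbs) ^ (p + 1)) := by
        rw [mul_mul_mul_comm, ← mul_pow, ← hP, ← pow_succ']
        omega

theorem cost_atom_mul_atom_le (p : ℕ) (i j : ℤ ⊕ ℕ × ℕ × ℤ) :
    cost p (atom i * atom j) ≤ weight p i * weight p j := by
  rw [← Nat.cast_mul]
  rcases i with i | κ <;> rcases j with j | κ'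
  exacts [cost_tau_mul_tau_le p i j, cost_tau_mul_cell_le p i κ', cost_cell_mul_tau_le p κ j,
    cost_cell_mul_cell_le p κ κ']

theorem cost_one_ne_top (p : ℕ) : cost p 1 ≠ ⊤ :=
  tau_zero ▸ ne_top_of_le_ne_top (ENNReal.natCast_ne_top _) (cost_tau_le p 0)

/-- The gauge on operators given by `cost p`. -/
def gauge (p : ℕ) : AlgebraGauge (H →L[ℂ] H) :=
  .atomic atom (fun i => weight p i) enorm_atom_le (one_le_coe_weight p) (cost_one_ne_top p)
    (cost_atom_mul_atom_le p)

/-- The operators with a rapidly decreasing expansion into atoms. -/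
def smooth : Subalgebra ℂ (H →L[ℂ] H) := ⨅ p, (gauge p).finite

theorem mem_smooth {x : H →L[ℂ] H} : x ∈ smooth ↔ ∀ p, cost p x ≠ ⊤ := by
  simp only [smooth, Algebra.mem_iInf, AlgebraGauge.mem_finite]
  rfl

/-! ### The symbol -/

/-- Truncations of the formal eigenvector `∑ k, exp (i k θ) • vec k 0 0` of `α`. -/
def planeWave (θ : ℝ) (N : ℕ) : H := ∑ k ∈ Finset.range N, chr k θ • vec k 0 0

theorem planeWave_succ (θ : ℝ) (N : ℕ) :
    planeWave θ (N + 1) = planeWave θ N + chr N θ • vec N 0 0 :=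
  Finset.sum_range_succ _ _

theorem norm_planeWave (θ : ℝ) (N : ℕ) : ‖planeWave θ N‖ = √N := by
  have orthonormal_vec : Orthonormal ℂ fun k => vec k 0 0 :=
    orthonormal_iff_ite.2 fun k k' => by simp [inner_vec_vec]
  have inner_self : ⟪planeWave θ N, planeWave θ N⟫_ℂ = N := by
    rw [planeWave, orthonormal_vec.inner_sum]
    simp [RCLike.conj_mul, norm_chr]
  rw [norm_eq_sqrt_re_inner (𝕜 := ℂ), inner_self, RCLike.natCast_re]

theorem frequently_planeWave_ne_zero (θ : ℝ) : ∃ᶠ N in atTop, planeWave θ N ≠ 0 :=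
  (eventually_gt_atTop 0).frequently.mono fun N hN => by
    rw [← norm_pos_iff, norm_planeWave]
    positivity

theorem mem_approxEigenpairs_of_norm_le {θ : ℝ} {T : H →L[ℂ] H} {z : ℂ} {C : ℝ}
    (h : ∀ N, ‖T (planeWave θ N) - z • planeWave θ N‖ ≤ C) :
    (T, z) ∈ approxEigenpairs atTop (planeWave θ) := by
  have tendsto_norm : Tendsto (fun N => ‖planeWave θ N‖) atTop atTop := by
    simpa only [norm_planeWave, Function.comp_def] using
      Real.tendsto_sqrt_atTop.comp tendsto_natCast_atTop_atTop
  refine mem_approxEigenpairs.2 ((IsBigO.of_bound C (.of_forall fun N => ?_)).trans_isLittleO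
    ((isLittleO_const_left_of_ne (one_ne_zero (α := ℝ))).2 tendsto_norm))
  simpa using h N

theorem α_mem_approxEigenpairs (θ : ℝ) :
    (α, chr 1 θ) ∈ approxEigenpairs atTop (planeWave θ) := by
  refine mem_approxEigenpairs_of_norm_le (C := 1) fun N => ?_
  rcases N with _ | N
  · simp [planeWave]
  have α_planeWave : α (planeWave θ (N + 1)) = chr 1 θ • planeWave θ N := by
    simp only [planeWave, Finset.sum_range_succ', map_add, map_sum, map_smul, α_vec_succ,
      α_vec_zero, smul_zero, add_zero, Nat.cast_add, Nat.cast_one, add_comm (_ : ℤ) 1, chr_add,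
      mul_smul, Finset.smul_sum]
  rw [α_planeWave, planeWave_succ, smul_add, sub_add_cancel_left, norm_neg]
  simp [norm_smul, norm_chr, norm_vec]

theorem star_α_mem_approxEigenpairs (θ : ℝ) :
    (star α, chr (-1) θ) ∈ approxEigenpairs atTop (planeWave θ) := by
  refine mem_approxEigenpairs_of_norm_le (C := 2) fun N => ?_
  have star_α_planeWave : star α (planeWave θ N) =
      chr (-1) θ • (planeWave θ (N + 1) - vec 0 0 0) := by
    simp only [planeWave, Finset.sum_range_succ', map_sum, map_smul, star_α_vec, Nat.cast_zero,
      chr_zero, one_smul, add_sub_cancel_right, Finset.smul_sum, smul_smul, ← chr_add,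
      Nat.cast_add, Nat.cast_one, neg_add_cancel_comm_assoc]
  rw [star_α_planeWave, planeWave_succ, ← smul_sub, norm_smul, norm_chr, one_mul, add_sub_assoc,
    add_sub_cancel_left]
  refine (norm_sub_le _ _).trans_eq ?_
  simp [norm_smul, norm_chr, norm_vec, one_add_one_eq_two]

theorem cell_mem_approxEigenpairs (κ : ℕ × ℕ × ℤ) (θ : ℝ) :
    (cell κ, 0) ∈ approxEigenpairs atTop (planeWave θ) := by
  obtain ⟨k, l, n⟩ := κ
  refine mem_approxEigenpairs_of_norm_le (C := 1) fun N => ?_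
  simp only [planeWave, map_sum, map_smul, cell_vec, smul_ite, smul_zero, zero_smul, sub_zero,
    Finset.sum_ite_eq']
  split_ifs <;> simp [norm_smul, norm_chr, norm_vec]

theorem tau_mem_approxEigenpairs (n : ℤ) (θ : ℝ) :
    (tau n, chr n θ) ∈ approxEigenpairs atTop (planeWave θ) := by
  unfold tau
  split_ifs with h
  · convert pow_mem (α_mem_approxEigenpairs θ) n.toNat using 1
    rw [Prod.pow_mk, chr_pow, mul_one, Int.toNat_of_nonneg h]
  · convert pow_mem (star_α_mem_approxEigenpairs θ) (-n).toNat using 1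
    rw [Prod.pow_mk, chr_pow, Int.toNat_of_nonneg (by omega)]
    simp

/-- The image of the series with coefficients `c` in the quotient of the C*-algebra by the ideal of
the `cell`s, which is the algebra of functions on the circle. -/
def symbol (c : ℤ ⊕ ℕ × ℕ × ℤ → ℂ) (θ : ℝ) : ℂ := ∑' n, chr n θ • c (.inl n)

section Symbol

variable {c c' : ℤ ⊕ ℕ × ℕ × ℤ → ℂ} {x : H →L[ℂ] H}

theorem mem_approxEigenpairs_symbol (hc : Summable fun i => ‖c i‖)
    (hx : HasSum (fun i => c i • atom i) x) (θ : ℝ) :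
    (x, symbol c θ) ∈ approxEigenpairs atTop (planeWave θ) := by
  have hasSum_inl : HasSum (fun n => chr n θ • c (.inl n)) (symbol c θ) :=
    (Summable.of_norm <| by
      simpa [norm_smul, norm_chr, Function.comp_def] using
        hc.comp_injective Sum.inl_injective).hasSum
  have hasSum_snd : HasSum (fun i => Sum.elim (chr · θ) 0 i • c i) (symbol c θ) :=
    (Sum.inl_injective.hasSum_iff (by rintro (n | κ) hi <;> simp_all)).1 hasSum_inl
  have hasSum_pair := hx.prodMk hasSum_snd
  rw [← hasSum_pair.tsum_eq]
  refine tsum_mem isClosed_approxEigenpairs fun i => ?_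
  rcases i with n | κ
  · simpa [atom_inl, mul_comm] using
      Subalgebra.smul_mem _ (tau_mem_approxEigenpairs n θ) (c (.inl n))
  · simpa [atom_inr] using Subalgebra.smul_mem _ (cell_mem_approxEigenpairs κ θ) (c (.inr κ))

theorem eq_zero_of_symbol_eq_zero (hc : Summable fun i => ‖c i‖) (h : ∀ θ, symbol c θ = 0)
    (n : ℤ) : c (.inl n) = 0 := by
  rw [← fourierCoeffTwoPi_tsum_chr_smul (c := fun n => c (.inl n))
    (hc.comp_injective Sum.inl_injective) n]
  change fourierCoeffTwoPi (fun θ => symbol c θ) n = 0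
  simp [h, fourierCoeffTwoPi_eq_integral]

theorem hasSum_cell_of_symbol_eq_zero (hc : Summable fun i => ‖c i‖) (h : ∀ θ, symbol c θ = 0)
    (hx : HasSum (fun i => c i • atom i) x) : HasSum (fun κ => c (.inr κ) • cell κ) x := by
  refine (Sum.inr_injective.hasSum_iff ?_).2 hx
  rintro (n | κ) hn
  · rw [eq_zero_of_symbol_eq_zero hc h, zero_smul]
  · exact (hn ⟨κ, rfl⟩).elim

theorem coef_of_hasSum_cell {d : ℕ × ℕ × ℤ → ℂ} (hx : HasSum (fun κ => d κ • cell κ) x)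
    (κ : ℕ × ℕ × ℤ) : coef κ x = d κ := by
  have hasSum_coef := hx.mapL (coef κ)
  have hasSum_single : HasSum (fun κ' => coef κ (d κ' • cell κ')) (d κ) := by
    convert hasSum_ite_eq κ (d κ) using 2 with κ'
    rw [map_smul, coef_cell]
    rcases eq_or_ne κ κ' with rfl | h
    · simp
    · simp [h, h.symm]
  exact hasSum_coef.unique hasSum_single

theorem coeff_unique (hc : Summable fun i => ‖c i‖) (hc' : Summable fun i => ‖c' i‖)
    (hx : HasSum (fun i => c i • atom i) x) (hx' : HasSum (fun i => c' i • atom i) x) :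
    c = c' := by
  have summable_sub : Summable fun i => ‖(c - c') i‖ :=
    (hc.add hc').of_nonneg_of_le (fun _ => norm_nonneg _) fun i => norm_sub_le _ _
  have hasSum_sub : HasSum (fun i => (c - c') i • atom i) 0 := by
    simpa [sub_smul] using hx.sub hx'
  have symbol_sub (θ : ℝ) : symbol (c - c') θ = 0 :=
    eq_of_mem_approxEigenpairs (frequently_planeWave_ne_zero θ)
      (mem_approxEigenpairs_symbol summable_sub hasSum_sub θ) (zero_mem _)
  refine sub_eq_zero.1 (funext (Sum.rec (eq_zero_of_symbol_eq_zero summable_sub symbol_sub)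
    fun κ => ?_))
  have := coef_of_hasSum_cell (hasSum_cell_of_symbol_eq_zero summable_sub symbol_sub hasSum_sub) κ
  rw [← this, map_zero, Pi.zero_apply]

end Symbol

/-! ### Expansions of smooth operators -/

theorem mem_smooth_iff_exists_hasSum {x : H →L[ℂ] H} :
    x ∈ smooth ↔ ∃ c : ℤ ⊕ ℕ × ℕ × ℤ → ℂ,
      RapidlyDecreasing size c ∧ HasSum (fun i => c i • atom i) x := by
  rw [mem_smooth]
  refine ⟨fun h => ?_, fun ⟨c, hc, hx⟩ p => ne_top_of_le_ne_top ?_ (atomicNorm_le hx)⟩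
  · choose c hx hc using fun p => exists_hasSum_of_atomicNorm_lt (lt_top_iff_ne_top.2 (h p))
    have tsum_size_ne_top (p : ℕ) : ∑' i, ‖c p i‖ₑ * (size i : ℝ≥0∞) ^ p ≠ ⊤ := by
      refine ne_top_of_le_ne_top (hc p).ne (ENNReal.tsum_le_tsum fun i => ?_)
      gcongr
      exact mod_cast size_pow_le_weight p i
    have summable_norm (p : ℕ) : Summable fun i => ‖c p i‖ := by
      refine tsum_enorm_ne_top_iff_summable_norm.1
        (ne_top_of_le_ne_top (hc p).ne (ENNReal.tsum_le_tsum fun i => ?_))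
      exact le_mul_of_one_le_right' (one_le_coe_weight p i)
    have eq_zero (p : ℕ) : c p = c 0 :=
      coeff_unique (summable_norm p) (summable_norm 0) (hx p) (hx 0)
    exact ⟨c 0, (rapidlyDecreasing_iff_tsum_ne_top isTempered_size).2
      fun p => eq_zero p ▸ tsum_size_ne_top p, hx 0⟩
  · have tsum_size_ne_top := (rapidlyDecreasing_iff_tsum_ne_top isTempered_size).1 hc (p + 1)
    refine ne_top_of_le_ne_top (ENNReal.mul_ne_top (a := 2) (by simp) tsum_size_ne_top) ?_
    rw [← ENNReal.tsum_mul_left]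
    refine ENNReal.tsum_le_tsum fun i => ?_
    rw [mul_left_comm]
    gcongr
    exact_mod_cast weight_le_size_pow p i

/-! ### The circle action -/

/-- The unitary representation of the circle by `exp (i d θ)` on the vectors of degree `d`. -/
def rotation (θ : ℝ) : H ≃L[ℂ] H :=
  .equivOfInverse
    (coordOp (fun p => chr (p.a - p.b) θ) id (fun _ => (norm_chr _ _).le)
      Function.injective_id.injOn)
    (coordOp (fun p => chr (p.b - p.a) θ) id (fun _ => (norm_chr _ _).le)
      Function.injective_id.injOn)
    (fun ξ => by ext p; simp [coordOp_apply, ← mul_assoc, ← chr_add, chr_zero])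
    (fun ξ => by ext p; simp [coordOp_apply, ← mul_assoc, ← chr_add, chr_zero])

theorem rotation_vec (θ : ℝ) (k : ℕ) (d : ℤ) (m : ℕ) :
    rotation θ (vec k d m) = chr d θ • vec k d m := by
  have degree_idx : ((idx k d m).a : ℤ) - (idx k d m).b = d := by
    simp only [idx]
    omega
  rw [vec, map_smul, smul_comm]
  congr 1
  ext q
  change chr (q.a - q.b) θ * e (idx k d m) q = chr d θ * e (idx k d m) q
  by_cases h : q = idx k d m
  · rw [h, degree_idx]
  · rw [e_apply_ne h, mul_zero, mul_zero]

theorem rotation_symm_vec (θ : ℝ) (k : ℕ) (d : ℤ) (m : ℕ) :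
    (rotation θ).symm (vec k d m) = chr (-d) θ • vec k d m := by
  rw [ContinuousLinearEquiv.symm_apply_eq, map_smul, rotation_vec, smul_smul, ← chr_add,
    neg_add_cancel, chr_zero, one_smul]

/-- The action of the circle on operators. -/
def conjRotation (θ : ℝ) : (H →L[ℂ] H) ≃A[ℂ] (H →L[ℂ] H) := (rotation θ).conjContinuousAlgEquiv

/-- The degree of an atom for the action of the circle. -/
def degree : ℤ ⊕ ℕ × ℕ × ℤ → ℤ := Sum.elim 0 (·.2.2)

theorem natAbs_degree_le_size (i : ℤ ⊕ ℕ × ℕ × ℤ) : (degree i).natAbs ≤ size i := by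
  rcases i with n | κ <;> simp [degree, size]

theorem conjRotation_atom (θ : ℝ) (i : ℤ ⊕ ℕ × ℕ × ℤ) :
    conjRotation θ (atom i) = chr (degree i) θ • atom i := by
  refine ext_vec fun j d m => ?_
  rw [conjRotation, ContinuousLinearEquiv.conjContinuousAlgEquiv_apply_apply, rotation_symm_vec,
    map_smul, map_smul, smul_apply]
  rcases i with n | ⟨k, l, n⟩
  · rw [atom_inl, tau_vec]
    split_ifs <;> simp [rotation_vec, smul_smul, ← chr_add, degree]
  · rw [atom_inr, cell_vec]
    split_ifs <;> simp [rotation_vec, smul_smul, ← chr_add, degree]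

theorem coef_conjRotation {x : H →L[ℂ] H} (hx : x ∈ cstarA) (κ : ℕ × ℕ × ℤ) (θ : ℝ) :
    coef κ (conjRotation θ x) = chr κ.2.2 θ • coef κ x := by
  refine eq_of_atom
    (φ := (coef κ).comp (conjRotation θ).toContinuousLinearEquiv.toContinuousLinearMap)
    (ψ := chr κ.2.2 θ • coef κ) (fun i => ?_) hx
  change coef κ (conjRotation θ (atom i)) = chr κ.2.2 θ • coef κ (atom i)
  rw [conjRotation_atom, map_smul]
  rcases i with n | κ'
  · rw [atom_inl, coef_tau]
    split_ifs with h <;> simp [h, degree]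
  · rw [atom_inr, coef_cell]
    split_ifs with h <;> simp [h, degree]

theorem contDiff_conjRotation_of_mem_smooth {x : H →L[ℂ] H} (hx : x ∈ smooth) :
    ContDiff ℝ ∞ fun θ => conjRotation θ x := by
  obtain ⟨c, hc, hx⟩ := mem_smooth_iff_exists_hasSum.1 hx
  have rapidlyDecreasing_smul : RapidlyDecreasing size fun i => c i • atom i := fun p => by
    obtain ⟨C, hC⟩ := hc p
    refine ⟨C, fun i => (hC i).trans' ?_⟩
    gcongr
    exact (norm_smul_le _ _).trans (mul_le_of_le_one_right (norm_nonneg _) (norm_atom_le i))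
  have conjRotation_eq_tsum (θ : ℝ) :
      conjRotation θ x = ∑' i, chr (degree i) θ • c i • atom i := by
    rw [← (hx.map (conjRotation θ) (conjRotation θ).continuous).tsum_eq]
    refine tsum_congr fun i => ?_
    rw [Function.comp_apply, map_smul, conjRotation_atom, smul_comm]
  simp only [conjRotation_eq_tsum]
  exact contDiff_tsum_chr_smul
    (rapidlyDecreasing_smul.summable_abs_pow_mul_norm isTempered_size natAbs_degree_le_size)

theorem contDiff_conjRotation_of_mul_eq_one {x y : H →L[ℂ] H}
    (hx : ContDiff ℝ ∞ fun θ => conjRotation θ x) (hxy : x * y = 1) (hyx : y * x = 1) :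
    ContDiff ℝ ∞ fun θ => conjRotation θ y := by
  let u (θ : ℝ) : (H →L[ℂ] H)ˣ :=
    Units.map (MonoidHomClass.toMonoidHom (conjRotation θ)) ⟨x, y, hxy, hyx⟩
  have conjRotation_eq_inverse (θ : ℝ) : conjRotation θ y = Ring.inverse (conjRotation θ x) :=
    (Ring.inverse_unit (u θ)).symm
  simp only [conjRotation_eq_inverse]
  exact contDiff_iff_contDiffAt.2 fun θ => ContDiffAt.comp (g := Ring.inverse) θ
    (contDiffAt_ringInverse ℝ (u θ)) hx.contDiffAt

theorem rapidlyDecreasing_coef_of_contDiff_conjRotation {x : H →L[ℂ] H} (hx : x ∈ cstarA)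
    (h : ContDiff ℝ ∞ fun θ => conjRotation θ x) :
    RapidlyDecreasing (fun κ : ℕ × ℕ × ℤ => 1 + κ.2.2.natAbs) fun κ => coef κ x := fun p => by
  refine ⟨_, fun κ => one_add_natAbs_pow_mul_le (norm_nonneg _) (norm_coef_le κ x)
    (D := ‖iteratedFDeriv ℝ p (fun θ => conjRotation θ x) 0‖) ?_⟩
  have norm_le := ((coef κ).restrictScalars ℝ).norm_iteratedFDeriv_comp_left
    (n := p) (h.contDiffAt (x := 0)) (mod_cast le_top)
  rw [← norm_iteratedFDeriv_chr_smul _ _ _ 0]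
  simp only [← coef_conjRotation hx]
  refine norm_le.trans (mul_le_of_le_one_left (norm_nonneg _)
    (ContinuousLinearMap.opNorm_le_bound _ zero_le_one fun z => ?_))
  rw [one_mul]
  exact norm_coef_le κ z

/-! ### Inverses of smooth operators -/

section Inverse

variable {c : ℤ ⊕ ℕ × ℕ × ℤ → ℂ} {x y : H →L[ℂ] H}

theorem contDiff_symbol (hc : RapidlyDecreasing size c) : ContDiff ℝ ∞ (symbol c) :=
  contDiff_tsum_chr_smul ((rapidlyDecreasing_sum.1 hc).1.summable_abs_pow_mul_norm isTempered_int
    fun n => by omega)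

theorem periodic_symbol (c : ℤ ⊕ ℕ × ℕ × ℤ → ℂ) :
    Function.Periodic (symbol c) (2 * Real.pi) := fun θ => by
  simp only [symbol, periodic_chr _ θ]

theorem exists_mem_smooth_forall_mem_approxEigenpairs {f : ℝ → ℂ} (hf : ContDiff ℝ ∞ f)
    (hper : Function.Periodic f (2 * Real.pi)) :
    ∃ T ∈ smooth, ∀ θ, (T, f θ) ∈ approxEigenpairs atTop (planeWave θ) := by
  let c : ℤ ⊕ ℕ × ℕ × ℤ → ℂ := Sum.elim (fourierCoeffTwoPi f) 0
  have hc : RapidlyDecreasing size c :=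
    rapidlyDecreasing_sum.2 ⟨rapidlyDecreasing_fourierCoeffTwoPi hf hper, fun p => ⟨0, by simp [c]⟩⟩
  have summable_c := hc.summable_norm isTempered_size
  have hasSum_c : HasSum (fun i => c i • atom i) (∑' i, c i • atom i) :=
    (summable_norm_smul_atom summable_c id).of_norm.hasSum
  refine ⟨_, mem_smooth_iff_exists_hasSum.2 ⟨c, hc, hasSum_c⟩, fun θ => ?_⟩
  rw [← (hasSum_chr_smul_fourierCoeffTwoPi hf hper θ).tsum_eq]
  exact mem_approxEigenpairs_symbol summable_c hasSum_c θ

theorem exists_hasSum_cell_of_mem_smooth (hx : x ∈ smooth)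
    (h : ∀ θ, (x, 0) ∈ approxEigenpairs atTop (planeWave θ)) :
    ∃ d : ℕ × ℕ × ℤ → ℂ, (∀ p : ℕ, ∑' κ, ‖d κ‖ₑ * (size (.inr κ) : ℝ≥0∞) ^ p ≠ ⊤) ∧
      HasSum (fun κ => d κ • cell κ) x := by
  obtain ⟨c, hc, hx⟩ := mem_smooth_iff_exists_hasSum.1 hx
  have summable_c := hc.summable_norm isTempered_size
  have symbol_eq_zero (θ : ℝ) : symbol c θ = 0 :=
    eq_of_mem_approxEigenpairs (frequently_planeWave_ne_zero θ)
      (mem_approxEigenpairs_symbol summable_c hx θ) (h θ)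
  refine ⟨fun κ => c (.inr κ), fun p => ?_,
    hasSum_cell_of_symbol_eq_zero summable_c symbol_eq_zero hx⟩
  exact ne_top_of_le_ne_top ((rapidlyDecreasing_iff_tsum_ne_top isTempered_size).1 hc p)
    (ENNReal.tsum_comp_le_tsum_of_injective Sum.inr_injective _)

theorem hasSum_cell_mul_mul_cell (hy : y ∈ cstarA)
    (hdec : RapidlyDecreasing (fun κ : ℕ × ℕ × ℤ => 1 + κ.2.2.natAbs) fun κ => coef κ y)
    (κ κ' : ℕ × ℕ × ℤ) :
    HasSum (fun m => coef (κ.2.1, κ'.1, m) y • cell (κ.1, κ'.2.1, κ.2.2 + m + κ'.2.2))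
      (cell κ * y * cell κ') := by
  have summable_coef : Summable fun m => ‖coef (κ.2.1, κ'.1, m) y‖ :=
    (hdec.comp (t := fun m : ℤ => 1 + m.natAbs) (fun m => (κ.2.1, κ'.1, m))
      fun m => le_rfl).summable_norm isTempered_int
  have summable_cell : Summable fun m =>
      coef (κ.2.1, κ'.1, m) y • cell (κ.1, κ'.2.1, κ.2.2 + m + κ'.2.2) :=
    (summable_norm_smul_atom summable_coef fun m =>
      .inr (κ.1, κ'.2.1, κ.2.2 + m + κ'.2.2)).of_norm
  convert summable_cell.hasSum using 1
  refine eq_of_coef (mul_mem (mul_mem (atom_mem_cstarA (.inr κ)) hy) (atom_mem_cstarA (.inr κ')))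
    (tsum_mem isClosed_cstarA fun m => SMulMemClass.smul_mem _ (atom_mem_cstarA (.inr _)))
    fun κ₁ => ?_
  rw [coef_cell_mul_mul_cell hy, ← (summable_cell.hasSum.mapL (coef κ₁)).tsum_eq,
    tsum_eq_single (κ₁.2.2 - κ.2.2 - κ'.2.2) fun m hm => ?_]
  · simp only [map_smul, coef_cell, smul_eq_mul, Prod.ext_iff]
    split_ifs with h h' h' <;> grind
  · rw [map_smul, coef_cell, if_neg fun h => hm ?_, smul_zero]
    simp only [Prod.ext_iff] at h
    omega

theorem exists_cost_cell_mul_mul_cell_le (hy : y ∈ cstarA)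
    (hdec : RapidlyDecreasing (fun κ : ℕ × ℕ × ℤ => 1 + κ.2.2.natAbs) fun κ => coef κ y) (p : ℕ) :
    ∃ C : ℝ≥0∞, C ≠ ⊤ ∧ ∀ κ κ', cost p (cell κ * y * cell κ') ≤
      C * (size (.inr κ) : ℝ≥0∞) ^ p * (size (.inr κ') : ℝ≥0∞) ^ p := by
  have hdec' := hdec.comp (t := fun q : (ℕ × ℕ) × ℤ => 1 + q.2.natAbs)
      (fun q => (q.1.1, q.1.2, q.2))
      fun q => le_refl (1 + q.2.natAbs)
  obtain ⟨C, hC, tsum_le⟩ := isTempered_int.exists_tsum_le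
    (a := fun (q : ℕ × ℕ) m => coef (q.1, q.2, m) y) hdec' p
  refine ⟨C, hC, fun κ κ' => ?_⟩
  have cost_cell_le (m : ℤ) : cost p (cell (κ.1, κ'.2.1, κ.2.2 + m + κ'.2.2)) ≤
      ((1 + m.natAbs : ℕ) : ℝ≥0∞) ^ p *
        ((size (.inr κ) : ℝ≥0∞) ^ p * (size (.inr κ') : ℝ≥0∞) ^ p) := by
    refine (cost_cell_le p _).trans ?_
    rw [← mul_pow, ← mul_pow, ← Nat.cast_mul, ← Nat.cast_mul, ← Nat.cast_pow]
    refine Nat.cast_le.2 (Nat.pow_le_pow_left ?_ p)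
    have size_le : size (.inr (κ.1, κ'.2.1, κ.2.2 + m + κ'.2.2)) ≤
        size (.inr (0, 0, m)) * size (.inr (κ.1, κ'.2.1, κ.2.2.natAbs + κ'.2.2.natAbs)) :=
      size_inr_le_mul (by dsimp only; omega)
    refine size_le.trans (Nat.mul_le_mul_left _ (size_inr_le_mul (by dsimp only; omega)))
  refine (atomicNorm_le_of_hasSum_smul enorm_atom_le (one_le_coe_weight p)
    (hasSum_cell_mul_mul_cell hy hdec κ κ')).trans ?_
  calc ∑' m, ‖coef (κ.2.1, κ'.1, m) y‖ₑ * cost p (cell (κ.1, κ'.2.1, κ.2.2 + m + κ'.2.2))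
      ≤ ∑' m, ‖coef (κ.2.1, κ'.1, m) y‖ₑ * ((1 + m.natAbs : ℕ) : ℝ≥0∞) ^ p *
          ((size (.inr κ) : ℝ≥0∞) ^ p * (size (.inr κ') : ℝ≥0∞) ^ p) := by
        refine ENNReal.tsum_le_tsum fun m => ?_
        rw [mul_assoc]
        gcongr
        exact cost_cell_le m
    _ ≤ C * (size (.inr κ) : ℝ≥0∞) ^ p * (size (.inr κ') : ℝ≥0∞) ^ p := by
        rw [ENNReal.tsum_mul_right, mul_assoc]
        gcongr
        exact tsum_le (κ.2.1, κ'.1)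

theorem mul_mul_mem_smooth (hy : y ∈ cstarA)
    (hdec : RapidlyDecreasing (fun κ : ℕ × ℕ × ℤ => 1 + κ.2.2.natAbs) fun κ => coef κ y)
    {r r' : H →L[ℂ] H} {d d' : ℕ × ℕ × ℤ → ℂ}
    (hd : ∀ p : ℕ, ∑' κ, ‖d κ‖ₑ * (size (.inr κ) : ℝ≥0∞) ^ p ≠ ⊤)
    (hd' : ∀ p : ℕ, ∑' κ, ‖d' κ‖ₑ * (size (.inr κ) : ℝ≥0∞) ^ p ≠ ⊤)
    (hr : HasSum (fun κ => d κ • cell κ) r) (hr' : HasSum (fun κ => d' κ • cell κ) r') :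
    r * y * r' ∈ smooth := by
  refine mem_smooth.2 fun p => ?_
  obtain ⟨C, hC, cost_le⟩ := exists_cost_cell_mul_mul_cell_le hy hdec p
  have hasSum_prod : HasSum (fun q : (ℕ × ℕ × ℤ) × (ℕ × ℕ × ℤ) =>
      (d q.1 * d' q.2) • (cell q.1 * y * cell q.2)) (r * y * r') := by
    have hd₀ : Summable fun κ => ‖d κ • cell κ‖ := summable_norm_smul_atom
      (tsum_enorm_ne_top_iff_summable_norm.1 (by simpa using hd 0)) .inr
    have hd₀' : Summable fun κ => ‖d' κ • cell κ‖ := summable_norm_smul_atom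
      (tsum_enorm_ne_top_iff_summable_norm.1 (by simpa using hd' 0)) .inr
    exact hasSum_smul_mul_mul (X := cell) (X' := cell) hd₀ hd₀' hr hr' y
  refine ne_top_of_le_ne_top (ENNReal.mul_ne_top (ENNReal.mul_ne_top hC (hd p)) (hd' p))
    ((atomicNorm_le_of_hasSum_smul enorm_atom_le (one_le_coe_weight p) hasSum_prod).trans ?_)
  calc ∑' q : (ℕ × ℕ × ℤ) × (ℕ × ℕ × ℤ), ‖d q.1 * d' q.2‖ₑ * cost p (cell q.1 * y * cell q.2)
      ≤ ∑' q : (ℕ × ℕ × ℤ) × (ℕ × ℕ × ℤ), C * (‖d q.1‖ₑ * (size (.inr q.1) : ℝ≥0∞) ^ p) *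
          (‖d' q.2‖ₑ * (size (.inr q.2) : ℝ≥0∞) ^ p) := by
        refine ENNReal.tsum_le_tsum fun q => ?_
        refine (mul_le_mul_right (cost_le q.1 q.2) _).trans_eq ?_
        rw [enorm_mul]
        ring
    _ = _ := by
        rw [ENNReal.tsum_prod']
        simp only [ENNReal.tsum_mul_left, ENNReal.tsum_mul_right]

theorem mem_smooth_of_mul_eq_one (hx : x ∈ smooth) (hy : y ∈ cstarA) (hxy : x * y = 1)
    (hyx : y * x = 1) : y ∈ smooth := by
  have hdec := rapidlyDecreasing_coef_of_contDiff_conjRotation hy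
    (contDiff_conjRotation_of_mul_eq_one (contDiff_conjRotation_of_mem_smooth hx) hxy hyx)
  obtain ⟨c, hc, hasSum_c⟩ := mem_smooth_iff_exists_hasSum.1 hx
  have symbol_mem := mem_approxEigenpairs_symbol (hc.summable_norm isTempered_size) hasSum_c
  have symbol_ne_zero (θ : ℝ) : symbol c θ ≠ 0 :=
    ne_zero_of_mem_approxEigenpairs (frequently_planeWave_ne_zero θ) (symbol_mem θ) hyx
  obtain ⟨T, hT, T_mem⟩ := exists_mem_smooth_forall_mem_approxEigenpairs
    (f := fun θ => (symbol c θ)⁻¹) ((contDiff_symbol hc).inv symbol_ne_zero) fun θ => by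
      simp only [periodic_symbol c θ]
  have one_sub_mul_mem (θ : ℝ) : (1 - x * T, 0) ∈ approxEigenpairs atTop (planeWave θ) := by
    convert sub_mem (one_mem _) (mul_mem (symbol_mem θ) (T_mem θ)) using 1
    simp [Prod.ext_iff, symbol_ne_zero θ]
  have one_sub_mul_mem' (θ : ℝ) : (1 - T * x, 0) ∈ approxEigenpairs atTop (planeWave θ) := by
    convert sub_mem (one_mem _) (mul_mem (T_mem θ) (symbol_mem θ)) using 1
    simp [Prod.ext_iff, symbol_ne_zero θ]
  obtain ⟨d, hd, hasSum_d⟩ := exists_hasSum_cell_of_mem_smooth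
    (sub_mem (one_mem _) (mul_mem hx hT)) one_sub_mul_mem
  obtain ⟨d', hd', hasSum_d'⟩ := exists_hasSum_cell_of_mem_smooth
    (sub_mem (one_mem _) (mul_mem hT hx)) one_sub_mul_mem'
  have y_eq : y = T + T * (1 - x * T) + (1 - T * x) * y * (1 - x * T) := by
    have mul_mul_self : (1 - T * x) * y * (1 - x * T) = y - T - T * (1 - x * T) := by
      calc (1 - T * x) * y * (1 - x * T)
          = y - y * x * T - T * (x * y) + T * (x * y) * x * T := by noncomm_ring
        _ = y - T - T * (1 - x * T) := by rw [hxy, hyx]; noncomm_ring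
    rw [mul_mul_self]
    abel
  rw [y_eq]
  exact add_mem (add_mem hT (mul_mem hT (sub_mem (one_mem _) (mul_mem hx hT))))
    (mul_mul_mem_smooth hy hdec hd' hd hasSum_d' hasSum_d)

end Inverse

/-! ### Comparison with the series in `α`, `β` and their adjoints -/

theorem hasSum_smul_cell_ofβ {f : ℝ → ℂ} (hf : Summable fun n => ‖fourierCoeffTwoPi f n‖)
    (k l : ℕ) :
    HasSum (fun n => fourierCoeffTwoPi f n • cell (k, l, n)) ((star α) ^ k * ofβ f * α ^ l) := by
  have summable_βpow : Summable fun n => fourierCoeffTwoPi f n • βpow n := by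
    have summable_cell := (summable_norm_smul_atom hf fun n => .inr (0, 0, n)).of_norm
    simpa only [atom_inr, cell, pow_zero, one_mul, mul_one] using summable_cell
  simpa only [cell, ofβ, mul_smul_comm, smul_mul_assoc] using
    (summable_βpow.hasSum.mul_left ((star α) ^ k)).mul_right (α ^ l)

theorem hasSum_ofβ_iff {f : ℕ → ℕ → ℝ → ℂ}
    (hf : Summable fun κ : ℕ × ℕ × ℤ => ‖fourierCoeffTwoPi (f κ.1 κ.2.1) κ.2.2‖)
    {x : H →L[ℂ] H} :
    HasSum (fun p : ℕ × ℕ => (star α) ^ p.1 * ofβ (f p.1 p.2) * α ^ p.2) x ↔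
      HasSum (fun κ => fourierCoeffTwoPi (f κ.1 κ.2.1) κ.2.2 • cell κ) x := by
  have summable_coeff (k l : ℕ) : Summable fun n => ‖fourierCoeffTwoPi (f k l) n‖ :=
    hf.comp_injective (i := fun n : ℤ => (k, l, n)) fun m n h => by simpa using h
  have hasSum_of_cell {y : H →L[ℂ] H}
      (hy : HasSum (fun κ => fourierCoeffTwoPi (f κ.1 κ.2.1) κ.2.2 • cell κ) y) :
      HasSum (fun p : ℕ × ℕ => (star α) ^ p.1 * ofβ (f p.1 p.2) * α ^ p.2) y :=
    ((Equiv.prodAssoc ℕ ℕ ℤ).hasSum_iff.2 hy).prod_fiberwise fun p =>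
      hasSum_smul_cell_ofβ (summable_coeff p.1 p.2) p.1 p.2
  refine ⟨fun hx => ?_, hasSum_of_cell⟩
  have hasSum_cell := (summable_norm_smul_atom hf .inr).of_norm.hasSum
  rwa [(hasSum_of_cell hasSum_cell).unique hx] at hasSum_cell

theorem SmoothRapidDecay.rapidlyDecreasing {f : ℕ → ℕ → ℝ → ℂ} (hf : SmoothRapidDecay f) :
    RapidlyDecreasing (fun κ => size (.inr κ))
      fun κ : ℕ × ℕ × ℤ => fourierCoeffTwoPi (f κ.1 κ.2.1) κ.2.2 := fun p => by
  have exists_bound (m : ℕ) : ∃ C, ∀ (k l : ℕ) (n : ℤ),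
      |(n : ℝ)| ^ m * ((1 + k + l : ℝ) ^ p * ‖fourierCoeffTwoPi (f k l) n‖) ≤ C := by
    obtain ⟨C, hC⟩ := hf.decay m p
    refine ⟨C, fun k l n => ?_⟩
    rw [mul_left_comm, ← le_div_iff₀' (by positivity)]
    exact abs_pow_mul_norm_fourierCoeffTwoPi_le (hf.contDiff k l) (hf.periodic k l)
      (fun θ => (le_div_iff₀' (by positivity)).2 (hC k l θ)) n
  obtain ⟨C, hC⟩ := exists_bound 0
  obtain ⟨D, hD⟩ := exists_bound p
  refine ⟨2 ^ (p - 1) * (C + D), fun ⟨k, l, n⟩ => ?_⟩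
  refine le_trans ?_ (one_add_natAbs_pow_mul_le (n := n) (by positivity)
    (by simpa using hC k l n) (hD k l n))
  have size_le : size (.inr (k, l, n)) ≤ (1 + n.natAbs) * (1 + k + l) := by
    rw [mul_comm, add_assoc 1 k l]
    refine le_trans ?_ (one_add_add_le_mul (k + l) n.natAbs)
    simp only [size, Sum.elim_inr]
    omega
  rw [← mul_assoc, ← mul_pow]
  gcongr
  exact_mod_cast size_le

theorem smoothRapidDecay_tsum_chr_smul {c : ℕ × ℕ × ℤ → ℂ}
    (hc : RapidlyDecreasing (fun κ => size (.inr κ)) c) :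
    SmoothRapidDecay fun k l θ => ∑' n, chr n θ • c (k, l, n) := by
  have hc_fiber (k l : ℕ) : ∀ p : ℕ, Summable fun n : ℤ => |(n : ℝ)| ^ p * ‖c (k, l, n)‖ :=
    (hc.comp (t := fun n : ℤ => 1 + n.natAbs) (fun n => (k, l, n)) fun n => by
      simp only [size, Sum.elim_inr]
      omega).summable_abs_pow_mul_norm isTempered_int (n := id) fun n => by simp
  refine ⟨fun k l => contDiff_tsum_chr_smul (hc_fiber k l), fun k l θ => ?_, fun m p =>
    ⟨∑' κ, (size (.inr κ) : ℝ) ^ (p + m) * ‖c κ‖, fun k l θ => ?_⟩⟩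
  · simp only [periodic_chr _ θ]
  have summable_size := (rapidlyDecreasing_iff_summable isTempered_size_inr).1 hc (p + m)
  have fiber_injective : Function.Injective fun n : ℤ => (k, l, n) := fun n n' h => by simpa using h
  have term_le (n : ℤ) : (1 + k + l : ℝ) ^ p * (|(n : ℝ)| ^ m * ‖c (k, l, n)‖) ≤
      (size (.inr (k, l, n)) : ℝ) ^ (p + m) * ‖c (k, l, n)‖ := by
    rw [← mul_assoc, pow_add, ← Int.cast_abs, Int.abs_eq_natAbs, Int.cast_natCast]
    gcongr <;> norm_cast <;> simp only [size, Sum.elim_inr] <;> omega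
  calc (1 + k + l : ℝ) ^ p * ‖iteratedDeriv m (fun θ => ∑' n, chr n θ • c (k, l, n)) θ‖
      ≤ (1 + k + l : ℝ) ^ p * ∑' n : ℤ, |(n : ℝ)| ^ m * ‖c (k, l, n)‖ := by
        gcongr
        exact norm_iteratedDeriv_tsum_chr_smul_le (hc_fiber k l) m θ
    _ = ∑' n : ℤ, (1 + k + l : ℝ) ^ p * (|(n : ℝ)| ^ m * ‖c (k, l, n)‖) := tsum_mul_left.symm
    _ ≤ ∑' n : ℤ, (size (.inr (k, l, n)) : ℝ) ^ (p + m) * ‖c (k, l, n)‖ :=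
        ((hc_fiber k l m).mul_left _).tsum_le_tsum term_le
          (summable_size.comp_injective fiber_injective)
    _ ≤ ∑' κ, (size (.inr κ) : ℝ) ^ (p + m) * ‖c κ‖ :=
        tsum_comp_le_tsum_of_inj summable_size (fun κ => by positivity) fiber_injective

theorem rapidlyDecreasing_of_rapidDecay {φ : ℤ → ℂ} {lam lam' : ℕ → ℂ} (hlam : RapidDecay lam)
    (hlam' : RapidDecay lam') (h : ∀ n : ℕ, φ n = lam n)
    (h' : ∀ n : ℕ, φ (-(n + 1)) = lam' (n + 1)) :
    RapidlyDecreasing (fun n : ℤ => 1 + n.natAbs) φ := fun p => by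
  obtain ⟨C, hC⟩ := hlam p
  obtain ⟨D, hD⟩ := hlam' p
  refine ⟨max C D, fun n => ?_⟩
  rcases n with n | n
  · exact le_max_of_le_left (by simpa [h] using hC n)
  · refine le_max_of_le_right ?_
    have abs_cast : |(n : ℝ) + 1| = n + 1 := abs_of_nonneg (by positivity)
    simpa [Int.negSucc_eq, h', -neg_add_rev, abs_cast] using hD (n + 1)

theorem rapidDecay_comp {φ : ℤ → ℂ}
    (hφ : RapidlyDecreasing (fun n : ℤ => 1 + n.natAbs) φ) {i : ℕ → ℤ}
    (hi : ∀ n, (i n).natAbs = n) : RapidDecay fun n => φ (i n) := fun p => by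
  obtain ⟨C, hC⟩ := hφ p
  exact ⟨C, fun n => by simpa [hi] using hC (i n)⟩

theorem tau_natCast (n : ℕ) : tau n = α ^ n := by simp [tau]

theorem tau_neg_natCast_add_one (n : ℕ) : tau (-(n + 1)) = star α ^ (n + 1) := by
  rw [tau, if_neg (by omega), neg_neg]
  rfl

theorem mem_smooth_of_mem_smoothA {x : H →L[ℂ] H} (hx : x ∈ smoothA) : x ∈ smooth := by
  obtain ⟨f, lam, lam', hf, hlam, hlam', x₁, x₂, x₃, hx₁, hx₂, hx₃, rfl⟩ := hx
  let φ : ℤ → ℂ := Int.rec lam fun n => lam' (n + 1)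
  have hφ := rapidlyDecreasing_of_rapidDecay hlam hlam' (φ := φ) (fun n => rfl) fun n => by
    rw [← Int.negSucc_eq]
  have hasSum_tau : HasSum (fun n => φ n • tau n) (x₂ + x₃) := .of_nat_of_neg_add_one
    (by simpa only [tau_natCast] using! hx₂)
    (by simpa only [tau_neg_natCast_add_one] using! hx₃)
  have hasSum_cell := (hasSum_ofβ_iff (hf.rapidlyDecreasing.summable_norm
    isTempered_size_inr)).1 hx₁
  refine mem_smooth_iff_exists_hasSum.2 ⟨Sum.elim φ _,
    rapidlyDecreasing_sum.2 ⟨hφ, hf.rapidlyDecreasing⟩, ?_⟩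
  rw [add_assoc, add_comm]
  exact HasSum.sum hasSum_tau hasSum_cell

theorem mem_smoothA_of_mem_smooth {x : H →L[ℂ] H} (hx : x ∈ smooth) : x ∈ smoothA := by
  obtain ⟨c, hc, hx⟩ := mem_smooth_iff_exists_hasSum.1 hx
  obtain ⟨hc_inl, hc_inr⟩ := rapidlyDecreasing_sum.1 hc
  have summable_inl := hc_inl.summable_norm isTempered_int
  have summable_inr := hc_inr.summable_norm isTempered_size_inr
  let f (k l : ℕ) (θ : ℝ) : ℂ := ∑' n, chr n θ • c (.inr (k, l, n))
  have coeff_eq (κ : ℕ × ℕ × ℤ) : fourierCoeffTwoPi (f κ.1 κ.2.1) κ.2.2 = c (.inr κ) :=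
    fourierCoeffTwoPi_tsum_chr_smul (summable_inr.comp_injective
      (i := fun n : ℤ => (κ.1, κ.2.1, n)) fun m n h => by simpa using h) κ.2.2
  obtain ⟨x₁, hx₁⟩ := (summable_norm_smul_atom summable_inr .inr).of_norm
  obtain ⟨x₂, hx₂⟩ := (summable_norm_smul_atom (d := fun n : ℕ => c (.inl n))
    (summable_inl.comp_injective Nat.cast_injective) fun n => .inl n).of_norm
  obtain ⟨x₃, hx₃⟩ := (summable_norm_smul_atom (d := fun n : ℕ => c (.inl (-(n + 1))))
    (summable_inl.comp_injective fun m n h => by simpa using h) fun n => .inl (-(n + 1))).of_norm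
  have eq_add : x = x₁ + x₂ + x₃ := by
    rw [add_assoc, add_comm]
    exact hx.unique (HasSum.sum (.of_nat_of_neg_add_one hx₂ hx₃) hx₁)
  simp only [atom_inl, tau_natCast, tau_neg_natCast_add_one] at hx₂ hx₃
  refine ⟨f, fun n => c (.inl n), fun n => c (.inl (-n)), smoothRapidDecay_tsum_chr_smul hc_inr,
    rapidDecay_comp hc_inl fun n => by simp, rapidDecay_comp hc_inl fun n => by simp,
    x₁, x₂, x₃, (hasSum_ofβ_iff ?_).2 ?_, hx₂, by simpa only [Nat.cast_add, Nat.cast_one] using hx₃,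
    eq_add⟩
  · simpa only [coeff_eq] using summable_inr
  · simpa only [coeff_eq] using! hx₁

theorem mem_cstarA_of_mem_smooth {x : H →L[ℂ] H} (hx : x ∈ smooth) : x ∈ cstarA := by
  obtain ⟨c, -, hx⟩ := mem_smooth_iff_exists_hasSum.1 hx
  rw [← hx.tsum_eq]
  exact tsum_mem isClosed_cstarA fun i => SMulMemClass.smul_mem _ (atom_mem_cstarA i)

theorem smoothA_subset_cstarA : smoothA ⊆ (cstarA : Set (H →L[ℂ] H)) := fun _ hx =>
  mem_cstarA_of_mem_smooth (mem_smooth_of_mem_smoothA hx)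

/-- The gauge `gauge p` on the C*-algebra. -/
def cstarAGauge (p : ℕ) : AlgebraGauge cstarA :=
  (gauge p).comap cstarA.subtype.toAlgHom isometry_subtype_coe

/-- The algebra of smooth operators as a subalgebra of the C*-algebra. -/
def smoothSubalgebra : Subalgebra ℂ cstarA := ⨅ p, (cstarAGauge p).finite

theorem mem_smoothSubalgebra_iff_mem_smooth {x : cstarA} :
    x ∈ smoothSubalgebra ↔ (x : H →L[ℂ] H) ∈ smooth := by
  rw [smoothSubalgebra, mem_smooth, Algebra.mem_iInf]
  rfl

theorem mem_smoothSubalgebra (x : cstarA) : x ∈ smoothSubalgebra ↔ (x : H →L[ℂ] H) ∈ smoothA :=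
  mem_smoothSubalgebra_iff_mem_smooth.trans ⟨mem_smoothA_of_mem_smooth, mem_smooth_of_mem_smoothA⟩

theorem inv_mem_smoothSubalgebra (x : cstarA) (hx : x ∈ smoothSubalgebra) (y : cstarA)
    (hxy : x * y = 1) (hyx : y * x = 1) : y ∈ smoothSubalgebra :=
  mem_smoothSubalgebra_iff_mem_smooth.2 <|
    mem_smooth_of_mul_eq_one (mem_smoothSubalgebra_iff_mem_smooth.1 hx) y.2
      (congrArg Subtype.val hxy) (congrArg Subtype.val hyx)

theorem stableUnderHolomorphicCalculus_smoothSubalgebra :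
    StableUnderHolomorphicCalculus smoothSubalgebra :=
  AlgebraGauge.stableUnderHolomorphicCalculus_iInf_finite cstarAGauge inv_mem_smoothSubalgebra

end SUq0

end

theorem proposition1 :
    SUq0.smoothA ⊆ (SUq0.cstarA : Set (SUq0.H →L[ℂ] SUq0.H)) ∧
    ∃ S : Subalgebra ℂ SUq0.cstarA,
      (∀ x : SUq0.cstarA, x ∈ S ↔ (x : SUq0.H →L[ℂ] SUq0.H) ∈ SUq0.smoothA) ∧
      (∀ x ∈ S, ∀ y : SUq0.cstarA, x * y = 1 → y * x = 1 → y ∈ S) ∧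
      StableUnderHolomorphicCalculus S := by
  exact ⟨SUq0.smoothA_subset_cstarA, SUq0.smoothSubalgebra, SUq0.mem_smoothSubalgebra,
    SUq0.inv_mem_smoothSubalgebra, SUq0.stableUnderHolomorphicCalculus_smoothSubalgebra⟩
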